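/- A \emph{semimetric} on a set $X$ is a map $d\colon X\times X\to[0,\infty]$ with $d(x,y)=0\iff x=y$ and $d(x,y)\le d(x,z)+d(z,y)$ (not necessarily symmetric). Put $\mathcal B^+_r(x)=\{y: d(x,y)\le r\}$ and $\mathcal B^-_r(x)=\{y: d(y,x)\le r\}$; for a set $S\subseteq X$ let $\mathcal B^\pm_r(S)=\bigcup_{x\in S}\mathcal B^\pm_r(x)$. The forward (backward) topology is generated by the open out-balls $\{y: d(x,y)<r\}$ (the open in-balls $\{y: d(y,x)<r\}$). Intervals $I\subseteq\mathbb R$ carry the directed semimetric that equals $t-s$ if $s\le t$ and $\infty$ otherwise. A map $I\to X$ is \emph{directed} if it is continuous with respect to the forward topologies and with respect to the backward topologies. A \emph{directed path} is a directed map $P\colon[a,b]\to X$ with $a<b$; its length is $\ell(P)=\lim_{N\to\infty}\sum_{i=1}^N d(P(t_{i-1}),P(t_i))$ with $t_i=a+i(b-a)/N$. It is a \emph{geodesic} if $\ell(P)=d(P(a),P(b))$. The space $X$ is \emph{geodesic} if there is a geodesic from $x$ to $y$ whenever $d(x,y)<\infty$. It is \emph{hyperbolic} if there is $\delta\ge0$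 such that, for all $x,y,z\in X$, every geodesic $P$ from $x$ to $y$, every geodesic $Q$ between $x$ and $z$ and every geodesic $R$ between $y$ and $z$ ($Q$ and $R$ directed either way), we have $P\subseteq\mathcal B^+_\delta(Q)\cup\mathcal B^-_\delta(R)$. It satisfies (B1) (respectively (B2)) if there is a function $\varphi$ such that for all $x\in X$, $r\ge0$ and all $y,z\in\mathcal B^+_r(x)$ (respectively $y,z\in\mathcal B^-_r(x)$), either $d(y,z)=\infty$ or $d(y,z)\le \varphi(r)$. A \emph{quasi-geodesic ray} is a directed map $R\colon[0,\infty)\to X$ that eventually leaves every out-ball $\mathcal B^+_r(x)$ and for which there are $\gamma\ge1$, $c\ge0$ with $\ell(R|_{[s,t]})\le\gamma\, d(R(s),R(t))+c$ for all $s<t$. A \emph{quasi-geodesic anti-ray} is a directed map $R\colon(-\infty,0]\to X$ that eventually (towards $-\infty$) leaves every in-ball $\mathcal B^-_r(x)$ and satisfies the same inequality for some $\gamma\ge 1$, $c\ge 0$. For quasi-geodesic rays or anti-rays write $R_1\le R_2$ if there is $M\ge0$ such that for all $r\ge0$, $x\in X$ there is a directed path of length at most $M$ from a point of $R_1$ to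 a point of $R_2$ that is disjoint from $\mathcal B^+_r(x)\cup\mathcal B^-_r(x)$, and write $R_1\approx R_2$ if $R_1\le R_2$ and $R_2\le R_1$. The \emph{quasi-geodesic boundary} $\partial X$ is the set of classes $[R]=\{Q: Q\approx R\}$ of quasi-geodesic rays and anti-rays; the \emph{quasi-geodesic f-boundary} $\partial^fX$ and \emph{b-boundary} $\partial^bX$ are defined in the same way using only quasi-geodesic rays and only quasi-geodesic anti-rays, respectively. For classes, $\eta\le\mu$ means that $R\le Q$ for some $R\in\eta$, $Q\in\mu$. A map $f\colon X_1\to X_2$ is a \emph{quasi-isometry} if there are $\gamma\ge1$, $c\ge0$ such that $\gamma^{-1}d(x,x')-c\le d(f(x),f(x'))\le\gamma d(x,x')+c$ for all $x,x'\in X_1$ and for every $y\in X_2$ there is $x\in X_1$ with $d(f(x),y)\le c$ and $d(y,f(x))\le c$. For a quasi-geodesic ray (anti-ray) $R$ of $X_1$ and a quasi-geodesic ray (anti-ray) $Q$ of $X_2$, say that $Q$ \emph{follows} $f(R)$ if there is $K\ge0$ such that the image of $Q$ lies in $\mathcal B^+_K(f(R))\cap\mathcal B^-_K(f(R))$ and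 $f(R)$ lies in $\mathcal B^+_K(Q)\cap\mathcal B^-_K(Q)$. \textbf{Theorem.} Let $X_1$ and $X_2$ be hyperbolic geodesic semimetric spaces that satisfy (B1) and (B2), and let $f\colon X_1\to X_2$ be a quasi-isometry. Then $f$ canonically defines three bijections $\partial^fX_1\to\partial^fX_2$, $\partial^bX_1\to\partial^bX_2$ and $\partial X_1\to\partial X_2$ that preserve the order in both directions ($\hat f(\eta)\le\hat f(\mu)\iff\eta\le\mu$). Here ``canonically'' means: for every quasi-geodesic ray (respectively anti-ray; respectively ray or anti-ray) $R$ of $X_1$ there is a quasi-geodesic ray (respectively anti-ray; respectively one of the same kind as $R$) $Q$ of $X_2$ that follows $f(R)$, and $\hat f([R])=[Q]$ for every such $Q$. -/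

import Mathlib

open Filter Set
open scoped NNReal ENNReal

/-- A semimetric: a distance with values in `[0, ∞]` satisfying the triangle inequality and
`d x y = 0 ↔ x = y`.  It need not be symmetric. -/
class SemimetricSpace (X : Type*) where
  sd : X → X → ℝ≥0∞
  sd_eq_zero_iff : ∀ x y, sd x y = 0 ↔ x = y
  sd_triangle : ∀ x y z, sd x y ≤ sd x z + sd z y

namespace SemimetricSpace

/-- The topology generated by the open out-balls of a distance function. -/
abbrev forwardTopology {X : Type*} (d : X → X → ℝ≥0∞) : TopologicalSpace X :=
  TopologicalSpace.generateFrom {U | ∃ (x : X) (r : ℝ≥0), U = {y | d x y < r}}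

/-- The topology generated by the open in-balls of a distance function. -/
abbrev backwardTopology {X : Type*} (d : X → X → ℝ≥0∞) : TopologicalSpace X :=
  TopologicalSpace.generateFrom {U | ∃ (x : X) (r : ℝ≥0), U = {y | d y x < r}}

/-- The semimetric of the directed real line, on which one can only move upwards.  Intervals are
the parameter spaces of directed paths; with the symmetric distance `|t - s|` instead, no directed
path could run through an edge of a digraph that can be traversed in one direction only. -/
noncomputable def directedDist (s t : ℝ) : ℝ≥0∞ :=
  if s ≤ t then ENNReal.ofReal (t - s) else ⊤

variable {X : Type*} [SemimetricSpace X]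

/-- The out-ball of radius `r` around `x`. -/
def outBall (x : X) (r : ℝ≥0) : Set X := {y | sd x y ≤ r}

/-- The in-ball of radius `r` around `x`. -/
def inBall (x : X) (r : ℝ≥0) : Set X := {y | sd y x ≤ r}

/-- The out-ball of radius `r` around a set. -/
def outBallSet (S : Set X) (r : ℝ≥0) : Set X := {y | ∃ x ∈ S, sd x y ≤ r}

/-- The in-ball of radius `r` around a set. -/
def inBallSet (S : Set X) (r : ℝ≥0) : Set X := {y | ∃ x ∈ S, sd y x ≤ r}

/-- `P`, restricted to the set `I` of reals, is continuous with respect to the forward topologies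
of `I` and `X`, and with respect to the backward topologies of `I` and `X`.  (The values of `P`
outside `I` are irrelevant.) -/
def IsDirectedOn (P : ℝ → X) (I : Set ℝ) : Prop :=
  @ContinuousOn ℝ X (forwardTopology directedDist) (forwardTopology sd) P I ∧
  @ContinuousOn ℝ X (backwardTopology directedDist) (backwardTopology sd) P I

/-- The restriction of `P` to `[a, b]` is a directed path (from `P a` to `P b`). -/
def IsDirectedPath (P : ℝ → X) (a b : ℝ) : Prop :=
  a < b ∧ IsDirectedOn P (Icc a b)

/-- The length of the restriction of `P` to `[a, b]`: the limit, over `N → ∞`, of the sums of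
distances along the subdivision of `[a, b]` into `N` equal pieces.  (The limit exists for every
directed path, so that it is the upper limit.) -/
noncomputable def pathLength (P : ℝ → X) (a b : ℝ) : ℝ≥0∞ :=
  limsup (fun N : ℕ => ∑ i ∈ Finset.range N,
    sd (P (a + i * (b - a) / N)) (P (a + (i + 1) * (b - a) / N))) atTop

/-- The restriction of `P` to `[a, b]` is a geodesic from `x` to `y`. -/
def IsGeodesic (P : ℝ → X) (a b : ℝ) (x y : X) : Prop :=
  IsDirectedPath P a b ∧ P a = x ∧ P b = y ∧ pathLength P a b = sd x y

variable (X) in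
/-- There is a geodesic from `x` to `y` whenever `d x y < ∞`. -/
def IsGeodesicSpace : Prop :=
  ∀ x y : X, sd x y < ⊤ → ∃ (P : ℝ → X) (a b : ℝ), IsGeodesic P a b x y

/-- `S` is the image of a geodesic from `x` to `y`. -/
def IsGeodesicImage (S : Set X) (x y : X) : Prop :=
  ∃ (P : ℝ → X) (a b : ℝ), IsGeodesic P a b x y ∧ S = P '' Icc a b

variable (X) in
/-- `δ`-hyperbolicity for some `δ`: for every geodesic triangle and every side `P` of it, say from
`x` to `y`, if `Q` is the side between `x` and the third end point `z`, and `R` the side between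
`y` and `z` (each directed either way), then `P` lies in the union of the `δ`-out-ball around `Q`
and the `δ`-in-ball around `R`. -/
def IsHyperbolic : Prop :=
  ∃ δ : ℝ≥0, ∀ (x y z : X) (P Q R : Set X),
    IsGeodesicImage P x y →
    (IsGeodesicImage Q x z ∨ IsGeodesicImage Q z x) →
    (IsGeodesicImage R y z ∨ IsGeodesicImage R z y) →
    P ⊆ outBallSet Q δ ∪ inBallSet R δ

variable (X) in
/-- (B1): finite distances between points of an out-ball are bounded in terms of its radius. -/
def PropB1 : Prop :=
  ∃ f : ℝ≥0 → ℝ≥0, ∀ (x : X) (r : ℝ≥0), ∀ y ∈ outBall x r, ∀ z ∈ outBall x r,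
    sd y z = ⊤ ∨ sd y z ≤ f r

variable (X) in
/-- (B2): finite distances between points of an in-ball are bounded in terms of its radius. -/
def PropB2 : Prop :=
  ∃ f : ℝ≥0 → ℝ≥0, ∀ (x : X) (r : ℝ≥0), ∀ y ∈ inBall x r, ∀ z ∈ inBall x r,
    sd y z = ⊤ ∨ sd y z ≤ f r

/-- `f` is a `(γ, c)`-quasi-isometry for some `γ ≥ 1`, `c ≥ 0`. -/
def IsQuasiIsometry {Y : Type*} [SemimetricSpace Y] (f : X → Y) : Prop :=
  ∃ γ c : ℝ≥0, 1 ≤ γ ∧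
    (∀ x x' : X, ((γ⁻¹ : ℝ≥0) : ℝ≥0∞) * sd x x' - c ≤ sd (f x) (f x') ∧
      sd (f x) (f x') ≤ γ * sd x x' + c) ∧
    (∀ y : Y, ∃ x : X, sd (f x) y ≤ c ∧ sd y (f x) ≤ c)

/-- `P` is quasi-geodesic on `I`: for some `γ ≥ 1`, `c ≥ 0`, the length of every subpath is at most
`γ` times the distance from its starting point to its end point plus `c`. -/
def IsQuasiGeodesicOn (P : ℝ → X) (I : Set ℝ) : Prop :=
  ∃ γ c : ℝ≥0, 1 ≤ γ ∧ ∀ s ∈ I, ∀ t ∈ I, s < t →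
    pathLength P s t ≤ γ * sd (P s) (P t) + c

variable (X) in
/-- Quasi-geodesic rays `[0, ∞) → X`; a ray eventually leaves every out-ball. -/
structure QGRay where
  toFun : Ici (0 : ℝ) → X
  directed : IsDirectedOn (IciExtend toFun) (Ici 0)
  leaves : ∀ (x : X) (r : ℝ≥0), ∃ p : Ici (0 : ℝ), ∀ t, p ≤ t → toFun t ∉ outBall x r
  quasiGeodesic : IsQuasiGeodesicOn (IciExtend toFun) (Ici 0)

variable (X) in
/-- Quasi-geodesic anti-rays `(-∞, 0] → X`; an anti-ray eventually (towards `-∞`) leaves every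
in-ball. -/
structure QGAntiRay where
  toFun : Iic (0 : ℝ) → X
  directed : IsDirectedOn (IicExtend toFun) (Iic 0)
  leaves : ∀ (x : X) (r : ℝ≥0), ∃ p : Iic (0 : ℝ), ∀ t, t ≤ p → toFun t ∉ inBall x r
  quasiGeodesic : IsQuasiGeodesicOn (IicExtend toFun) (Iic 0)

/-- The relation `U ≤ V`, which for (anti-)rays depends only on their images: for some `M`, outside
every `B⁺_r(x) ∪ B⁻_r(x)` there is a directed path of length at most `M` from `U` to `V`. -/
def SetLE (U V : Set X) : Prop :=
  ∃ M : ℝ≥0, ∀ (r : ℝ≥0) (x : X), ∃ (P : ℝ → X) (a b : ℝ),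
    IsDirectedPath P a b ∧ P a ∈ U ∧ P b ∈ V ∧ pathLength P a b ≤ M ∧
    Disjoint (P '' Icc a b) (outBall x r ∪ inBall x r)

/-- The relation `≤` on quasi-geodesic rays. -/
def rayLE (R Q : QGRay X) : Prop := SetLE (range R.toFun) (range Q.toFun)

/-- The relation `≤` on quasi-geodesic anti-rays. -/
def antiRayLE (R Q : QGAntiRay X) : Prop := SetLE (range R.toFun) (range Q.toFun)

/-- The image of a quasi-geodesic ray or anti-ray. -/
def image : QGRay X ⊕ QGAntiRay X → Set X :=
  Sum.elim (fun R => range R.toFun) (fun R => range R.toFun)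

/-- The relation `≤` on quasi-geodesic rays and anti-rays together. -/
def bothLE (R Q : QGRay X ⊕ QGAntiRay X) : Prop := SetLE (image R) (image Q)

/-- The set of classes `{Q | R ≤ Q and Q ≤ R}` of a relation `≤` on `A`. -/
def Classes {A : Type*} (le : A → A → Prop) : Type _ :=
  {η : Set A // ∃ R, η = {Q | le R Q ∧ le Q R}}

/-- The class of `R`. -/
def classOf {A : Type*} (le : A → A → Prop) (R : A) : Classes le :=
  ⟨{Q | le R Q ∧ le Q R}, R, rfl⟩

/-- The relation on classes that is induced by the relation on representatives. -/
instance {A : Type*} (le : A → A → Prop) : LE (Classes le) :=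
  ⟨fun η μ => ∃ R ∈ η.1, ∃ Q ∈ μ.1, le R Q⟩

variable (X) in
/-- The quasi-geodesic f-boundary. -/
abbrev FBoundary : Type _ := Classes (rayLE (X := X))

variable (X) in
/-- The quasi-geodesic b-boundary. -/
abbrev BBoundary : Type _ := Classes (antiRayLE (X := X))

variable (X) in
/-- The quasi-geodesic boundary. -/
abbrev Boundary : Type _ := Classes (bothLE (X := X))

/-- `U` and `V` lie uniformly close to and from each other. -/
def CloseSets (U V : Set X) : Prop :=
  ∃ K : ℝ≥0, U ⊆ outBallSet V K ∩ inBallSet V K ∧ V ⊆ outBallSet U K ∩ inBallSet U K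

section maps

variable {Y : Type*} [SemimetricSpace Y]

/-- The ray `Q` lies close to and from the image of the ray `R` under `f`. -/
def rayFollows (f : X → Y) (R : QGRay X) (Q : QGRay Y) : Prop :=
  CloseSets (f '' range R.toFun) (range Q.toFun)

/-- The anti-ray `Q` lies close to and from the image of the anti-ray `R` under `f`. -/
def antiRayFollows (f : X → Y) (R : QGAntiRay X) (Q : QGAntiRay Y) : Prop :=
  CloseSets (f '' range R.toFun) (range Q.toFun)

/-- `R` and `Q` are both rays or both anti-rays, and `Q` lies close to and from the image of `R`
under `f`. -/
def bothFollows (f : X → Y) : QGRay X ⊕ QGAntiRay X → QGRay Y ⊕ QGAntiRay Y → Prop :=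
  Sum.LiftRel (rayFollows f) (antiRayFollows f)

end maps

/-- The map `F` between classes is the canonical one defined by the relation `follows` on
representatives: every `R` is followed by some `Q`, and `F` sends the class of `R` to the class of
every such `Q`.  There is at most one such `F`. -/
def IsCanonicalMap {A B : Type*} {leA : A → A → Prop} {leB : B → B → Prop}
    (follows : A → B → Prop) (F : Classes leA → Classes leB) : Prop :=
  ∀ R : A, (∃ Q : B, follows R Q) ∧
    ∀ Q : B, follows R Q → F (classOf leA R) = classOf leB Q

/-- `F` is a bijection that preserves the order in both directions. -/
def IsOrderBijection {S T : Type*} [LE S] [LE T] (F : S → T) : Prop :=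
  Function.Bijective F ∧ ∀ η μ : S, F η ≤ F μ ↔ η ≤ μ

end SemimetricSpace

/-!
Quasi-isometries between hyperbolic geodesic semimetric spaces with (B1) and (B2) induce order
isomorphisms of the quasi-geodesic boundaries.

The order on the boundary depends only on sequences.  A quasi-geodesic ray can be replaced by a
sequence of points at successive distance `1`, and this sequence is quasi-geodesic
(`IsHypSpace.exists_discretization`); conversely, joining the points of a quasi-geodesic sequence
by geodesics yields a quasi-geodesic ray (`IsHypSpace.exists_realization`).  Anti-rays are treated
as rays of the opposite space `Op X`.  By (B1) and (B2) such sequences leave all balls, so that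
`R ≤ Q` for (anti-)rays means that there are pairs of arbitrarily late points of the two sequences
at bounded distance (`IsHypSpace.bothLE_iff`).  In this form the order is visibly preserved by
quasi-isometries in both directions, and the image of a quasi-geodesic sequence under a
quasi-isometry is quasi-geodesic.  What remains is that the order is transitive, so that the classes
and the maps between them make sense.

Transitivity (`IsHypSpace.seqLE_trans`) is where hyperbolicity enters.  If `u ≤ v` and `v` runs in
the direction of a ray, then the late points of `v` are uniformly close from `u`, by stability of
quasi-geodesics applied to a quadrilateral with two short sides; hence connections from `v` to `w`
extend to connections from `u` to `w`.  If `v` runs in the direction of an anti-ray, the same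
argument applies in the opposite space.

For stability the lack of symmetry has to be overcome.  Hyperbolicity places each point of a side
of a triangle close *from* one side or close *to* another one, and repeated use would mix the
directions.  The remedy is that (B1) and (B2), which bound finite distances in balls by an arbitrary
function of the radius, then hold with linear bounds (`IsHypSpace.out_bound_linear`).  It follows
that two points at small distance have almost the same distance to every third point that both of
them reach (`IsHypSpace.rdist_le_of_within`), with an error linear in the small distance, and that
in a directed triangle `x → m → y` the side from `x` to `y` is close from the other two
(`IsHypSpace.exists_within_of_triangle`).  Iterating the latter shows that geodesics are
logarithmically close from chains, and the classical proof of stability goes through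
(`IsHypSpace.isShadowed_of_isQGChain`).

Throughout, `y` is close *from* `x`, and `x` is close *to* `y`, if the distance from `x` to `y` is
small.
-/

namespace SemimetricSpace

/-! ### Finite distances, opposite spaces and arc-length geodesics -/

/-- The opposite of a semimetric space, in which all distances are reversed.  Passing to it
exchanges out-balls with in-balls and rays with anti-rays. -/
def Op (X : Type*) : Type _ := X

instance {X : Type*} [SemimetricSpace X] : SemimetricSpace (Op X) where
  sd x y := sd (X := X) y x
  sd_eq_zero_iff x y := by rw [sd_eq_zero_iff (X := X) y x]; exact eq_comm
  sd_triangle x y z := by rw [add_comm]; exact sd_triangle (X := X) y x z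

variable {X : Type*} [SemimetricSpace X]

theorem sd_self (x : X) : sd x x = 0 := (sd_eq_zero_iff x x).2 rfl

/-- The point `y` is at finite distance from `x`. -/
def Reach (x y : X) : Prop := sd x y ≠ ⊤

/-- The distance as a real number; it is `0` if the distance is infinite, so that it carries
information only together with `Reach`. -/
noncomputable def rdist (x y : X) : ℝ := (sd x y).toReal

/-- The distance from `x` to `y` is finite and at most the real number `r`. -/
def Within (x y : X) (r : ℝ) : Prop := Reach x y ∧ rdist x y ≤ r

theorem Reach.refl (x : X) : Reach x x := by simp [Reach, sd_self]

theorem Reach.trans {x y z : X} (h : Reach x y) (h' : Reach y z) : Reach x z :=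
  ne_top_of_le_ne_top (ENNReal.add_ne_top.2 ⟨h, h'⟩) (sd_triangle x z y)

theorem rdist_nonneg (x y : X) : 0 ≤ rdist x y := ENNReal.toReal_nonneg

@[simp] theorem rdist_self (x : X) : rdist x x = 0 := by simp [rdist, sd_self]

theorem rdist_triangle {x y z : X} (h : Reach x y) (h' : Reach y z) :
    rdist x z ≤ rdist x y + rdist y z := by
  unfold rdist
  rw [← ENNReal.toReal_add h h']
  exact ENNReal.toReal_mono (ENNReal.add_ne_top.2 ⟨h, h'⟩) (sd_triangle x z y)

theorem Within.nonneg {x y : X} {r : ℝ} (h : Within x y r) : 0 ≤ r :=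
  (rdist_nonneg x y).trans h.2

theorem Within.refl (x : X) {r : ℝ} (hr : 0 ≤ r) : Within x x r := ⟨Reach.refl x, by simpa⟩

theorem Within.mono {x y : X} {r s : ℝ} (h : Within x y r) (hrs : r ≤ s) : Within x y s :=
  ⟨h.1, h.2.trans hrs⟩

theorem Within.trans {x y z : X} {r s : ℝ} (h : Within x y r) (h' : Within y z s) :
    Within x z (r + s) :=
  ⟨h.1.trans h'.1, (rdist_triangle h.1 h'.1).trans (add_le_add h.2 h'.2)⟩

theorem Reach.within {x y : X} (h : Reach x y) : Within x y (rdist x y) := ⟨h, le_rfl⟩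

theorem within_iff {x y : X} {r : ℝ} (hr : 0 ≤ r) : Within x y r ↔ sd x y ≤ ENNReal.ofReal r := by
  constructor
  · rintro ⟨h, h'⟩
    exact (ENNReal.le_ofReal_iff_toReal_le h hr).2 h'
  · intro h
    have h1 : sd x y ≠ ⊤ := ne_top_of_le_ne_top ENNReal.ofReal_ne_top h
    exact ⟨h1, (ENNReal.le_ofReal_iff_toReal_le h1 hr).1 h⟩

theorem within_iff_nnreal {x y : X} {r : ℝ≥0} : Within x y r ↔ sd x y ≤ r := by
  rw [within_iff r.coe_nonneg, ENNReal.ofReal_coe_nnreal]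

/-- The function `g`, restricted to `[0, ℓ]`, is a geodesic from `x` to `y` that is parametrized by
arc length. -/
structure IsGeo (g : ℝ → X) (ℓ : ℝ) (x y : X) : Prop where
  length_nonneg : 0 ≤ ℓ
  left : g 0 = x
  right : g ℓ = y
  reach : ∀ s t, 0 ≤ s → s ≤ t → t ≤ ℓ → Reach (g s) (g t)
  rdist_eq : ∀ s t, 0 ≤ s → s ≤ t → t ≤ ℓ → rdist (g s) (g t) = t - s

namespace IsGeo

variable {g : ℝ → X} {ℓ : ℝ} {x y : X}

theorem within (h : IsGeo g ℓ x y) {s t : ℝ} (hs : 0 ≤ s) (hst : s ≤ t) (ht : t ≤ ℓ) :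
    Within (g s) (g t) (t - s) :=
  ⟨h.reach s t hs hst ht, (h.rdist_eq s t hs hst ht).le⟩

theorem within_left (h : IsGeo g ℓ x y) {s : ℝ} (hs : 0 ≤ s) (hs' : s ≤ ℓ) :
    Within x (g s) s := by
  simpa [h.left] using h.within le_rfl hs hs'

theorem within_right (h : IsGeo g ℓ x y) {s : ℝ} (hs : 0 ≤ s) (hs' : s ≤ ℓ) :
    Within (g s) y (ℓ - s) := by
  simpa [h.right] using h.within hs hs' le_rfl

theorem rdist_left (h : IsGeo g ℓ x y) {s : ℝ} (hs : 0 ≤ s) (hs' : s ≤ ℓ) :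
    rdist x (g s) = s := by
  simpa [h.left] using h.rdist_eq 0 s le_rfl hs hs'

theorem rdist_right (h : IsGeo g ℓ x y) {s : ℝ} (hs : 0 ≤ s) (hs' : s ≤ ℓ) :
    rdist (g s) y = ℓ - s := by
  simpa [h.right] using h.rdist_eq s ℓ hs hs' le_rfl

theorem length_eq (h : IsGeo g ℓ x y) : rdist x y = ℓ := by
  simpa [h.right] using h.rdist_left h.length_nonneg le_rfl

theorem reach_ends (h : IsGeo g ℓ x y) : Reach x y := by
  simpa [h.right] using (h.within_left h.length_nonneg le_rfl).1

theorem sub (h : IsGeo g ℓ x y) {a b : ℝ} (ha : 0 ≤ a) (hab : a ≤ b) (hb : b ≤ ℓ) :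
    IsGeo (fun s => g (a + s)) (b - a) (g a) (g b) where
  length_nonneg := by linarith
  left := by simp
  right := by simp
  reach s t hs hst ht := h.reach _ _ (by linarith) (by linarith) (by linarith)
  rdist_eq s t hs hst ht := by
    rw [h.rdist_eq _ _ (by linarith) (by linarith) (by linarith)]; ring

theorem op (h : IsGeo g ℓ x y) : IsGeo (X := Op X) (fun s => g (ℓ - s)) ℓ y x where
  length_nonneg := h.length_nonneg
  left := by rw [sub_zero]; exact h.right
  right := by rw [sub_self]; exact h.left
  reach s t hs hst ht := h.reach _ _ (by linarith) (by linarith) (by linarith)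
  rdist_eq s t hs hst ht :=
    (h.rdist_eq _ _ (by linarith) (by linarith) (by linarith)).trans (by ring)

end IsGeo

/-- The properties of a hyperbolic geodesic semimetric space with (B1) and (B2), expressed by
arc-length geodesics and real distances; `δ` is the hyperbolicity constant and `φ` bounds the finite
distances within balls. -/
structure IsHypSpace (X : Type*) [SemimetricSpace X] (δ : ℝ) (φ : ℝ → ℝ) : Prop where
  exists_geo : ∀ x y : X, Reach x y → ∃ g, IsGeo g (rdist x y) x y
  thin : ∀ {x y z : X} {g h k : ℝ → X} {ℓ m n : ℝ}, IsGeo g ℓ x y →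
    (IsGeo h m x z ∨ IsGeo h m z x) → (IsGeo k n y z ∨ IsGeo k n z y) → ∀ s, 0 ≤ s → s ≤ ℓ →
    (∃ t, 0 ≤ t ∧ t ≤ m ∧ Within (h t) (g s) δ) ∨ (∃ t, 0 ≤ t ∧ t ≤ n ∧ Within (g s) (k t) δ)
  out_bound : ∀ {x y z : X} {r : ℝ}, Within x y r → Within x z r → Reach y z → rdist y z ≤ φ r
  in_bound : ∀ {x y z : X} {r : ℝ}, Within y x r → Within z x r → Reach y z → rdist y z ≤ φ r

theorem IsHypSpace.op {δ : ℝ} {φ : ℝ → ℝ} (H : IsHypSpace X δ φ) : IsHypSpace (Op X) δ φ where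
  exists_geo x y hxy := by
    obtain ⟨g, hg⟩ := H.exists_geo y x hxy
    exact ⟨_, hg.op⟩
  thin {x y z g h k ℓ m n} hg hh hk s hs hs' := by
    have := H.thin (x := y) (y := x) (z := z) (s := ℓ - s) (IsGeo.op (X := Op X) hg)
      (hk.imp (IsGeo.op (X := Op X)) (IsGeo.op (X := Op X))).symm
      (hh.imp (IsGeo.op (X := Op X)) (IsGeo.op (X := Op X))).symm (by linarith) (by linarith)
    simp only [sub_sub_cancel] at this
    rcases this with ⟨t, ht, ht', hW⟩ | ⟨t, ht, ht', hW⟩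
    · exact Or.inr ⟨n - t, by linarith, by linarith, hW⟩
    · exact Or.inl ⟨m - t, by linarith, by linarith, hW⟩
  out_bound hxy hxz hyz := H.in_bound (X := X) hxz hxy hyz
  in_bound hxy hxz hyz := H.out_bound (X := X) hxz hxy hyz

/-! ### Linear bounds for distances in balls -/

/-- Distances in out-balls grow at most linearly with the radius.  Along a geodesic from `y` to `z`
consider points at a mutual distance larger than `φ (δ + 1)`.  Those that are not close to the
geodesic from `x` to `z` are close from points of the geodesic from `x` to `y`, and two of them
cannot be close from the same unit piece of it. -/
theorem IsHypSpace.out_bound_linear {δ : ℝ} {φ : ℝ → ℝ} (H : IsHypSpace X δ φ) :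
    ∃ K : ℝ, 0 ≤ K ∧ ∀ {x y z : X} {r : ℝ}, Within x y r → Within x z r → Reach y z →
      rdist y z ≤ K * (r + 1) := by
  set K : ℝ := |φ (1 + δ)| + 1 with hK
  have hK0 : 0 < K := by positivity
  refine ⟨|δ| + 1 + K, by positivity, ?_⟩
  intro x y z r hxy hxz hyz
  have hr : 0 ≤ r := hxy.nonneg
  by_contra! hlt
  obtain ⟨g, hg⟩ := H.exists_geo y z hyz
  obtain ⟨h, hh⟩ := H.exists_geo x y hxy.1
  obtain ⟨k, hk⟩ := H.exists_geo x z hxz.1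
  have hδ := le_abs_self δ
  have hδ0 := abs_nonneg δ
  -- every point at distance at most `K * (r + 1)` from `y` is close from the side `h`
  have key : ∀ s, 0 ≤ s → s ≤ K * (r + 1) →
      ∃ t, 0 ≤ t ∧ t ≤ rdist x y ∧ Within (h t) (g s) δ := by
    intro s hs hs'
    have hsl : s ≤ rdist y z := by nlinarith
    refine (H.thin hg (Or.inr hh) (Or.inr hk) s hs hsl).resolve_right ?_
    rintro ⟨t, ht, ht', hW⟩
    have h1 := (hW.trans (hk.within_right ht ht')).2
    rw [hg.rdist_right hs hsl] at h1
    have := hxz.2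
    nlinarith
  have key' : ∀ i : ℕ, i < ⌊r⌋₊ + 2 →
      ∃ t, 0 ≤ t ∧ t ≤ rdist x y ∧ Within (h t) (g (i * K)) δ := by
    intro i hi
    apply key _ (by positivity)
    have h1 : (i : ℝ) ≤ ⌊r⌋₊ + 1 := by exact_mod_cast Nat.lt_succ_iff.1 hi
    have := Nat.floor_le hr
    nlinarith
  choose! t ht0 htr htW using key'
  have hle : ∀ i < ⌊r⌋₊ + 2, (i : ℝ) * K ≤ rdist y z := by
    intro i hi
    have h1 : (i : ℝ) ≤ ⌊r⌋₊ + 1 := by exact_mod_cast Nat.lt_succ_iff.1 hi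
    have := Nat.floor_le hr
    nlinarith
  obtain ⟨i, hi, j, hj, hij, hEq⟩ := Finset.exists_ne_map_eq_of_card_lt_of_maps_to
    (s := Finset.range (⌊r⌋₊ + 2)) (t := Finset.range (⌊r⌋₊ + 1)) (f := fun i => ⌊t i⌋₊)
    (by simp) (by
      intro i hi
      have hi : i < ⌊r⌋₊ + 2 := by simpa using hi
      simpa [Nat.lt_succ_iff] using Nat.floor_le_floor ((htr i hi).trans hxy.2))
  wlog hlt' : i < j generalizing i j
  · exact this j hj i hi hij.symm hEq.symm (lt_of_le_of_ne (not_lt.1 hlt') hij.symm)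
  have hi : i < ⌊r⌋₊ + 2 := by simpa using hi
  have hj : j < ⌊r⌋₊ + 2 := by simpa using hj
  have close : ∀ l < ⌊r⌋₊ + 2, Within (h ⌊t l⌋₊) (g (l * K)) (1 + δ) := by
    intro l hl
    have h1 := Nat.floor_le (ht0 l hl)
    have h2 := Nat.lt_floor_add_one (t l)
    exact ((hh.within (by positivity) h1 (htr l hl)).trans (htW l hl)).mono (by linarith)
  have hci := close i hi
  rw [show ⌊t i⌋₊ = ⌊t j⌋₊ from hEq] at hci
  have hij' : (i : ℝ) + 1 ≤ j := by exact_mod_cast hlt'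
  have hijK : (i : ℝ) * K ≤ j * K := by nlinarith
  have h3 := H.out_bound hci (close j hj) (hg.reach _ _ (by positivity) hijK (hle j hj))
  rw [hg.rdist_eq _ _ (by positivity) hijK (hle j hj)] at h3
  have := le_abs_self (φ (1 + δ))
  nlinarith

/-- The properties of a hyperbolic geodesic semimetric space with (B1) and (B2), where one constant
`A` serves as the hyperbolicity constant and in linear bounds for (B1) and (B2). -/
abbrev IsLinHypSpace (X : Type*) [SemimetricSpace X] (A : ℝ) : Prop :=
  IsHypSpace X A (fun r => A * (r + 1))

theorem IsHypSpace.exists_linear {δ : ℝ} {φ : ℝ → ℝ} (H : IsHypSpace X δ φ) :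
    ∃ A, 1 ≤ A ∧ IsLinHypSpace X A := by
  obtain ⟨K, hK, h1⟩ := H.out_bound_linear
  obtain ⟨K', hK', h2⟩ := H.op.out_bound_linear
  have hδ := le_abs_self δ
  have hδ0 := abs_nonneg δ
  have hA : δ ≤ 1 + |δ| + K + K' := by linarith
  refine ⟨1 + |δ| + K + K', by linarith, H.exists_geo, ?_, ?_, ?_⟩
  · intro x y z g h k ℓ m n hg hh hk s hs hs'
    rcases H.thin hg hh hk s hs hs' with ⟨t, ht, ht', hW⟩ | ⟨t, ht, ht', hW⟩
    · exact Or.inl ⟨t, ht, ht', hW.mono hA⟩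
    · exact Or.inr ⟨t, ht, ht', hW.mono hA⟩
  · intro x y z r hxy hxz hyz
    have hr := hxy.nonneg
    exact (h1 hxy hxz hyz).trans (by gcongr; linarith)
  · intro x y z r hxy hxz hyz
    have hr := hxy.nonneg
    exact (h2 (x := x) (y := z) (z := y) hxz hxy hyz).trans (by gcongr; linarith)

/-! ### Thin triangles with a short side -/

/-- The loss in the comparison of the distances from (or to) two points at distance `M`. -/
def loss (A M : ℝ) : ℝ := A * (M + A + 1) + A + 1

theorem loss_nonneg {A M : ℝ} (hA : 1 ≤ A) (hM : 0 ≤ M) : 0 ≤ loss A M := by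
  unfold loss; positivity

/-- If a property of real numbers holds at `0` but not at `u`, then it is lost within some interval
of length at most `1`. -/
theorem exists_jump {p : ℝ → Prop} {u : ℝ} (hu : 0 ≤ u) (h0 : p 0) (hp : ¬ p u) :
    ∃ a b, 0 ≤ a ∧ a ≤ b ∧ b ≤ u ∧ b ≤ a + 1 ∧ p a ∧ ¬ p b := by
  set S : Set ℝ := {a | 0 ≤ a ∧ a ≤ u ∧ p a}
  have hbdd : BddAbove S := ⟨u, fun a ha => ha.2.1⟩
  obtain ⟨a, ⟨ha0, hau, hpa⟩, ha⟩ :=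
    exists_lt_of_lt_csSup (⟨0, le_rfl, hu, h0⟩ : S.Nonempty)
      (show sSup S - 1 / 2 < sSup S by linarith)
  by_cases hua : u ≤ a + 1
  · exact ⟨a, u, ha0, hau, le_rfl, hua, hpa, hp⟩
  · refine ⟨a, a + 1, ha0, by linarith, by linarith, le_rfl, hpa, fun hc => ?_⟩
    have := le_csSup hbdd (show a + 1 ∈ S from ⟨by linarith, by linarith, hc⟩)
    linarith

namespace IsHypSpace

variable {A : ℝ}

/-- If `x` is close from `z`, then `y` is not much farther from `x` than from `z`: the triangle
`z`, `x`, `y` is thin, so that a point of the geodesic from `x` to `y` is close to a point of the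
geodesic from `z` to `y` as soon as it is not close from `x`. -/
theorem rdist_le_of_within (H : IsLinHypSpace X A) (hA : 1 ≤ A) {x y z : X} {M : ℝ}
    (hzx : Within z x M) (hzy : Reach z y) (hxy : Reach x y) :
    rdist x y ≤ rdist z y + loss A M := by
  have hM := hzx.nonneg
  obtain ⟨g, hg⟩ := H.exists_geo x y hxy
  obtain ⟨h, hh⟩ := H.exists_geo z x hzx.1
  obtain ⟨k, hk⟩ := H.exists_geo z y hzy
  have hzy0 := rdist_nonneg z y
  set s := A * (M + A + 1) + 1 with hs
  have hs0 : 0 ≤ s := by positivity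
  by_contra! hlt
  have hsl : s ≤ rdist x y := by unfold loss at hlt; linarith
  rcases H.thin hg (Or.inr hh) (Or.inr hk) s hs0 hsl with ⟨t, ht, ht', hW⟩ | ⟨t, ht, ht', hW⟩
  · have h1 := (hh.within_left ht ht').trans hW
    have h2 := H.out_bound (hzx.mono (by linarith : M ≤ M + A))
      (h1.mono (by linarith [hzx.2])) (hg.within_left hs0 hsl).1
    rw [hg.rdist_left hs0 hsl] at h2
    linarith
  · have h1 := (hW.trans (hk.within_right ht ht')).2
    rw [hg.rdist_right hs0 hsl] at h1
    unfold loss at hlt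
    linarith

theorem rdist_le_of_within' (H : IsLinHypSpace X A) (hA : 1 ≤ A) {x y z : X} {M : ℝ}
    (hxz : Within x z M) (hyz : Reach y z) (hyx : Reach y x) :
    rdist y x ≤ rdist y z + loss A M :=
  H.op.rdist_le_of_within hA hxz hyz hyx

/-- If `x` is close from `z`, then the geodesic from `x` to `y` is close to the geodesic from `z`
to `y`. -/
theorem exists_within_of_short_side (H : IsLinHypSpace X A) (hA : 1 ≤ A) {x y z : X} {M ℓ n : ℝ}
    {g k : ℝ → X} (hzx : Within z x M) (hg : IsGeo g ℓ x y) (hk : IsGeo k n z y) {s : ℝ}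
    (hs : 0 ≤ s) (hs' : s ≤ ℓ) : ∃ t, 0 ≤ t ∧ t ≤ n ∧ Within (g s) (k t) (loss A M) := by
  have hM := hzx.nonneg
  obtain ⟨h, hh⟩ := H.exists_geo z x hzx.1
  rcases H.thin hg (Or.inr hh) (Or.inr hk) s hs hs' with ⟨t, ht, ht', hW⟩ | ⟨t, ht, ht', hW⟩
  swap
  · exact ⟨t, ht, ht', hW.mono (by unfold loss; nlinarith)⟩
  -- points of `g` that are close from `[z, x]` lie near `x`, so move along `g` past them
  set u := A * (M + A + 1) + 1 with hu
  have hu0 : 0 ≤ u := by positivity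
  have near : ∀ {s t}, 0 ≤ s → s ≤ ℓ → 0 ≤ t → t ≤ rdist z x → Within (h t) (g s) A → s < u := by
    intro s t hs hs' ht ht' hW
    have h1 := (hh.within_left ht ht').trans hW
    have h2 := H.out_bound (hzx.mono (by linarith : M ≤ M + A))
      (h1.mono (by linarith [hzx.2])) (hg.within_left hs hs').1
    rw [hg.rdist_left hs hs'] at h2
    linarith
  have hsu := near hs hs' ht ht' hW
  by_cases hul : u ≤ ℓ
  · rcases H.thin hg (Or.inr hh) (Or.inr hk) u hu0 hul with ⟨v, hv, hv', hW'⟩ | ⟨v, hv, hv', hW'⟩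
    · exact absurd (near hu0 hul hv hv' hW') (lt_irrefl _)
    · exact ⟨v, hv, hv', ((hg.within hs hsu.le hul).trans hW').mono (by unfold loss; linarith)⟩
  · refine ⟨n, hk.length_nonneg, le_rfl, ?_⟩
    rw [hk.right]
    exact (hg.within_right hs hs').mono (by unfold loss; linarith)

/-- If `x` is close from `z`, then the geodesic from `z` to `y` is close from the geodesic from `x`
to `y`, except for an initial piece, which may be out of reach from `x`.  The point of the second
geodesic lying a bounded distance before `k t` is close to a point `k t'`, and comparing distances
to `y` shows that `t'` is at most `t` and not far from it. -/
theorem exists_within_of_short_side' (H : IsLinHypSpace X A) (hA : 1 ≤ A) {M : ℝ} :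
    ∃ E, ∀ {x y z : X} {ℓ n : ℝ} {g k : ℝ → X}, Within z x M → IsGeo g ℓ x y → IsGeo k n z y →
      ∀ t, E ≤ t → 0 ≤ t → t ≤ n → ∃ s, 0 ≤ s ∧ s ≤ ℓ ∧ Within (g s) (k t) E := by
  set C := loss A M
  refine ⟨M + C + C + (M + C) + C + loss A C, ?_⟩
  intro x y z ℓ n g k hzx hg hk t ht ht0 htn
  have hM := hzx.nonneg
  have hC : 0 ≤ C := loss_nonneg hA hM
  have hC' : 0 ≤ loss A C := loss_nonneg hA hC
  have hn : n ≤ M + ℓ := by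
    have := (hzx.trans (hg.within_left hg.length_nonneg le_rfl)).2
    rw [hg.right, hk.length_eq] at this
    exact this
  have hℓ : ℓ ≤ n + C := by
    have := H.rdist_le_of_within hA hzx hk.reach_ends hg.reach_ends
    rwa [hg.length_eq, hk.length_eq] at this
  -- `g s` is close to a point `k t'` at a similar distance from `y`, so `t'` is slightly below `t`
  have hs : 0 ≤ t - (M + C) := by linarith
  have hsl : t - (M + C) ≤ ℓ := by linarith
  obtain ⟨t', ht', htn', hW⟩ := H.exists_within_of_short_side hA hzx hg hk hs hsl
  have h1 := H.rdist_le_of_within hA hW (hg.within_right hs hsl).1 (hk.within_right ht' htn').1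
  have h2 := (hW.trans (hk.within_right ht' htn')).2
  rw [hg.rdist_right hs hsl] at h1 h2
  rw [hk.rdist_right ht' htn'] at h1
  have htt : t' ≤ t := by linarith
  exact ⟨_, hs, hsl, (hW.trans (hk.within ht' htt htn)).mono (by linarith)⟩

/-- In a directed triangle `x → m → y` the geodesic from `x` to `y` is close from the other two
sides.  The points that hyperbolicity places close to the side from `m` to `y` lie behind a point
that is both close from the first side and close to the second one, whence the comparison
with a short side applies to them. -/
theorem exists_within_of_triangle (H : IsLinHypSpace X A) (hA : 1 ≤ A) :
    ∃ C, 0 ≤ C ∧ ∀ {x m y : X} {a b ℓ : ℝ} {h k g : ℝ → X}, IsGeo h a x m → IsGeo k b m y →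
      IsGeo g ℓ x y → ∀ s, 0 ≤ s → s ≤ ℓ →
      (∃ t, 0 ≤ t ∧ t ≤ a ∧ Within (h t) (g s) C) ∨
        (∃ t, 0 ≤ t ∧ t ≤ b ∧ Within (k t) (g s) C) := by
  obtain ⟨E, hE⟩ := H.exists_within_of_short_side' hA (M := 1 + A)
  have hE0 := le_abs_self E
  have hE1 := abs_nonneg E
  refine ⟨A + |E|, by linarith, ?_⟩
  intro x m y a b ℓ h k g hh hk hg s hs hs'
  by_cases hsP : ∃ t, 0 ≤ t ∧ t ≤ a ∧ Within (h t) (g s) A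
  · obtain ⟨t, ht, ht', hW⟩ := hsP
    exact Or.inl ⟨t, ht, ht', hW.mono (by linarith)⟩
  obtain ⟨s₁, s₂, h0s, h12, h2s, hs2, ⟨t, ht, hta, hW⟩, hs₂⟩ :=
    exists_jump (p := fun u => ∃ t, 0 ≤ t ∧ t ≤ a ∧ Within (h t) (g u) A) hs
      ⟨0, le_rfl, hh.length_nonneg, by
        rw [hh.left, hg.left]; exact Within.refl _ (by linarith)⟩ hsP
  have h1s := h12.trans h2s
  obtain ⟨r, hr, hrb, hW'⟩ := (H.thin hg (Or.inl hh) (Or.inr hk) s₂ (by linarith)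
    (by linarith)).resolve_left hs₂
  have hshort : Within (g s₁) (k r) (1 + A) :=
    ((hg.within h0s h12 (by linarith)).trans hW').mono (by linarith)
  by_cases hEs : E ≤ s - s₁
  · right
    have hks := hk.sub hr hrb le_rfl
    have hgs := hg.sub h0s (h1s.trans hs') le_rfl
    rw [hk.right] at hks
    rw [hg.right] at hgs
    obtain ⟨u, hu, hub, hWu⟩ := hE hshort hks hgs (s - s₁) hEs (by linarith) (by linarith)
    refine ⟨r + u, by linarith, by linarith, ?_⟩
    simp only [add_sub_cancel] at hWu
    exact hWu.mono (by linarith)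
  · left
    exact ⟨t, ht, hta, (hW.trans (hg.within h0s h1s hs')).mono (by linarith)⟩

end IsHypSpace

/-! ### Stability of quasi-geodesics -/

/-- The points `x 0, …, x n` form a chain with steps of length at most `T`. -/
def IsChain (x : ℕ → X) (n : ℕ) (T : ℝ) : Prop := ∀ i < n, Within (x i) (x (i + 1)) T

theorem IsChain.reach {x : ℕ → X} {n : ℕ} {T : ℝ} (hx : IsChain x n T) {i j : ℕ} (hij : i ≤ j)
    (hj : j ≤ n) : Reach (x i) (x j) := by
  induction j, hij using Nat.le_induction with
  | base => exact Reach.refl _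
  | succ j hij ih => exact (ih (by omega)).trans (hx j (by omega)).1

theorem IsChain.within {x : ℕ → X} {n : ℕ} {T : ℝ} (hx : IsChain x n T) {i j : ℕ} (hij : i ≤ j)
    (hj : j ≤ n) : Within (x i) (x j) (((j : ℝ) - i) * T) := by
  induction j, hij using Nat.le_induction with
  | base => simpa using Within.refl _ le_rfl
  | succ j hij ih =>
    refine ((ih (by omega)).trans (hx j (by omega))).mono ?_
    push_cast
    linarith

theorem IsChain.op {x : ℕ → X} {n : ℕ} {T : ℝ} (hx : IsChain x n T) :
    IsChain (X := Op X) (fun i => x (n - i)) n T := by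
  intro i hi
  have := hx (n - (i + 1)) (by omega)
  rwa [show n - (i + 1) + 1 = n - i by omega] at this

namespace IsHypSpace

variable {A : ℝ}

/-- A geodesic lies logarithmically close from every chain with the same end points. -/
theorem exists_within_chain (H : IsLinHypSpace X A) (hA : 1 ≤ A) :
    ∃ C, 0 ≤ C ∧ ∀ {T : ℝ}, 0 ≤ T → ∀ (k : ℕ) {x : ℕ → X} {n : ℕ} {g : ℝ → X} {ℓ : ℝ},
      n ≤ 2 ^ k → IsChain x n T → IsGeo g ℓ (x 0) (x n) → ∀ s, 0 ≤ s → s ≤ ℓ →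
      ∃ i ≤ n, Within (x i) (g s) (C * k + T) := by
  obtain ⟨C, hC, hC'⟩ := H.exists_within_of_triangle hA
  refine ⟨C, hC, ?_⟩
  intro T hT k
  induction k with
  | zero =>
    intro x n g ℓ hn hx hg s hs hs'
    have hℓ : ℓ ≤ T := by
      rw [← hg.length_eq]
      have := (hx.within (Nat.zero_le n) le_rfl).2
      have hn' : (n : ℝ) ≤ 1 := by exact_mod_cast hn
      simp only [Nat.cast_zero, sub_zero] at this
      nlinarith
    exact ⟨0, Nat.zero_le _, (hg.within_left hs hs').mono (by simpa using hs'.trans hℓ)⟩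
  | succ k ih =>
    intro x n g ℓ hn hx hg s hs hs'
    set m := n / 2 with hm
    rw [pow_succ] at hn
    obtain ⟨h, hh⟩ := H.exists_geo (x 0) (x m) (hx.reach (Nat.zero_le _) (by omega))
    obtain ⟨k', hk'⟩ := H.exists_geo (x m) (x n) (hx.reach (by omega) le_rfl)
    rcases hC' hh hk' hg s hs hs' with ⟨t, ht, ht', hW⟩ | ⟨t, ht, ht', hW⟩
    · obtain ⟨i, hi, hW'⟩ := ih (x := x) (n := m) (by omega)
        (fun i hi => hx i (by omega)) hh t ht ht'
      exact ⟨i, by omega, (hW'.trans hW).mono (by push_cast; linarith)⟩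
    · obtain ⟨i, hi, hW'⟩ := ih (x := fun i => x (m + i)) (n := n - m) (by omega)
        (fun i hi => hx (m + i) (by omega))
        (by simpa [show m + (n - m) = n by omega] using hk') t ht ht'
      exact ⟨m + i, by omega, (hW'.trans hW).mono (by push_cast; linarith)⟩

end IsHypSpace

/-- A quasi-geodesic chain: the number of steps between two of its points is bounded linearly in
their distance. -/
structure IsQGChain (x : ℕ → X) (n : ℕ) (T γ c : ℝ) : Prop where
  chain : IsChain x n T
  quasi : ∀ i j, i ≤ j → j ≤ n → (j : ℝ) - i ≤ γ * rdist (x i) (x j) + c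

theorem IsQGChain.op {x : ℕ → X} {n : ℕ} {T γ c : ℝ} (hx : IsQGChain x n T γ c) :
    IsQGChain (X := Op X) (fun i => x (n - i)) n T γ c where
  chain := hx.chain.op
  quasi i j hij hj := by
    have := hx.quasi (n - j) (n - i) (by omega) (by omega)
    rw [Nat.cast_sub hj, Nat.cast_sub (hij.trans hj)] at this
    exact le_trans (by linarith) this

/-- Linear functions grow more slowly than the inverse of the logarithm: for large `D` a linear
expression in `D` is at most `2 ^ k` for some `k` which is small compared with `D`. -/
theorem exists_pow_bound (a b C C' : ℝ) (hC : 0 ≤ C) :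
    ∃ D₀ : ℕ, ∀ D : ℕ, D₀ ≤ D → ∃ k : ℕ, a * D + b ≤ 2 ^ k ∧ C * k + C' ≤ D := by
  obtain ⟨N, hN⟩ : ∃ N : ℕ, ∀ k : ℕ, N ≤ k →
      |a| * ((C + 1) * (k + 1) + |C'|) + |b| ≤ 2 ^ k := by
    have h1 : Tendsto (fun k : ℕ => (k : ℝ) ^ 1 / 2 ^ k) atTop (nhds 0) :=
      tendsto_pow_const_div_const_pow_of_one_lt 1 one_lt_two
    have h0 : Tendsto (fun k : ℕ => (k : ℝ) ^ 0 / 2 ^ k) atTop (nhds 0) :=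
      tendsto_pow_const_div_const_pow_of_one_lt 0 one_lt_two
    have h2 := (h1.const_mul (|a| * (C + 1))).add
      (h0.const_mul (|a| * (C + 1) + |a| * |C'| + |b|))
    simp only [mul_zero, add_zero] at h2
    obtain ⟨N, hN⟩ := eventually_atTop.1 (h2.eventually (gt_mem_nhds one_pos))
    refine ⟨N, fun k hk => ?_⟩
    have h3 := (hN k hk).le
    have h4 : (0 : ℝ) < 2 ^ k := by positivity
    rw [mul_div_assoc', mul_div_assoc', ← add_div, div_le_one h4] at h3
    simp only [pow_one, pow_zero, mul_one] at h3
    linarith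
  have hpos : 0 < C + 1 := by linarith
  refine ⟨⌈(C + 1) * N + |C'|⌉₊, fun D hD => ?_⟩
  have hD : (C + 1) * N + |C'| ≤ D := Nat.ceil_le.1 hD
  have hq : (N : ℝ) ≤ (D - |C'|) / (C + 1) := by rw [le_div_iff₀ hpos]; linarith
  have hq0 : 0 ≤ ((D : ℝ) - |C'|) / (C + 1) := le_trans (by positivity) hq
  set k := ⌊((D : ℝ) - |C'|) / (C + 1)⌋₊ with hk
  have h1 := Nat.floor_le hq0
  have h2 := Nat.lt_floor_add_one (((D : ℝ) - |C'|) / (C + 1))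
  rw [← hk, le_div_iff₀ hpos] at h1
  rw [← hk, div_lt_iff₀ hpos] at h2
  have hb := le_abs_self b
  have hc := le_abs_self C'
  have hk0 : (0 : ℝ) ≤ k := by positivity
  refine ⟨k, le_trans ?_ (hN k (Nat.le_floor hq)), by nlinarith⟩
  have hD0 : (0 : ℝ) ≤ D := by positivity
  have : a * D ≤ |a| * ((C + 1) * (k + 1) + |C'|) :=
    mul_le_mul (le_abs_self a) (by linarith) hD0 (abs_nonneg a)
  linarith

/-- The geodesic `g` of length `ℓ` lies within distance `D` from and to the points
`x 0, …, x n`. -/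
def IsShadowed (x : ℕ → X) (n : ℕ) (g : ℝ → X) (ℓ D : ℝ) : Prop :=
  ∀ s, 0 ≤ s → s ≤ ℓ → (∃ i ≤ n, Within (x i) (g s) D) ∧ ∃ i ≤ n, Within (g s) (x i) D

theorem IsShadowed.op {x : ℕ → X} {n : ℕ} {g : ℝ → X} {ℓ D : ℝ} (h : IsShadowed x n g ℓ D) :
    IsShadowed (X := Op X) (fun i => x (n - i)) n (fun s => g (ℓ - s)) ℓ D := by
  intro s hs hs'
  obtain ⟨⟨i, hi, hW⟩, j, hj, hW'⟩ := h (ℓ - s) (by linarith) (by linarith)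
  refine ⟨⟨n - j, by omega, ?_⟩, n - i, by omega, ?_⟩
  · rw [← Nat.sub_sub_self hj] at hW'; exact hW'
  · rw [← Nat.sub_sub_self hi] at hW; exact hW

namespace IsHypSpace

variable {A : ℝ}

/-- Given a point `x v` of a quasi-geodesic chain that is close to a point `g b` of a geodesic
which is shadowed by the chain, some point `g a` with `a ≤ u`, where `u ≤ b` is given, is close to
a point `x j` with `j ≤ v` and `v - j` bounded.  If the points that are close from `g u` are all
behind `x v`, then `a` is chosen where the points of the chain that are close from `g a` jump
across `x v`; by (B1) they cannot jump far. -/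
theorem exists_left_anchor (H : IsLinHypSpace X A) (hA : 1 ≤ A) {x : ℕ → X} {n : ℕ}
    {T γ c D : ℝ} (hγ : 0 ≤ γ) (hx : IsQGChain x n T γ c) {g : ℝ → X} {ℓ : ℝ}
    (hg : IsGeo g ℓ (x 0) (x n)) (hD : 0 ≤ D) (hsh : IsShadowed x n g ℓ D) {u b : ℝ} (hu : 0 ≤ u)
    (hub : u ≤ b) (hb : b ≤ ℓ) {v : ℕ} (hv : v ≤ n) (hvb : Within (x v) (g b) D) :
    ∃ a, 0 ≤ a ∧ a ≤ u ∧ ∃ j ≤ v, Within (g a) (x j) D ∧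
      (v : ℝ) - j ≤ γ * (b - u + 2 * loss A D + A * (D + 2)) + c := by
  have hl := loss_nonneg hA hD
  by_cases huS : ∃ j ≤ v, Within (g u) (x j) D
  · obtain ⟨j, hj, hW⟩ := huS
    refine ⟨u, hu, le_rfl, j, hj, hW, (hx.quasi j v hj hv).trans ?_⟩
    have hjv := hx.chain.reach hj hv
    have h1 := H.rdist_le_of_within hA hW (hg.within hu hub hb).1 (hjv.trans hvb.1)
    have h2 := H.rdist_le_of_within' hA hvb (hjv.trans hvb.1) hjv
    rw [hg.rdist_eq _ _ hu hub hb] at h1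
    have : 0 ≤ A * (D + 2) := by positivity
    gcongr
    linarith
  obtain ⟨a, a', ha0, haa, hau', ha1, ⟨j, hj, hW⟩, ha'⟩ :=
    exists_jump (p := fun a => ∃ j ≤ v, Within (g a) (x j) D) hu
      ⟨0, Nat.zero_le _, by rw [hg.left]; exact Within.refl _ hD⟩ huS
  have hau := haa.trans hau'
  obtain ⟨j', hj', hW'⟩ := (hsh a' (by linarith) (by linarith)).2
  have hvj : v < j' := by
    by_contra! hle
    exact ha' ⟨j', hle, hW'⟩
  refine ⟨a, ha0, hau, j, hj, hW, ?_⟩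
  have h1 := H.out_bound (hW.mono (by linarith : D ≤ D + 1))
    (((hg.within ha0 haa (by linarith)).trans hW').mono (by linarith))
    (hx.chain.reach (hj.trans hvj.le) hj')
  have h2 := hx.quasi j j' (hj.trans hvj.le) hj'
  have h3 : (v : ℝ) ≤ j' := by exact_mod_cast hvj.le
  have h4 : γ * rdist (x j) (x j') ≤ γ * (b - u + 2 * loss A D + A * (D + 2)) := by
    gcongr
    linarith
  linarith

/-- The inductive step in the proof of stability: if a geodesic lies within a large distance `D + 1`
from and to a quasi-geodesic chain, then it lies within distance `D` from the chain.  Near a point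
of the geodesic, replace a piece of it of length about `4 D` by a detour along the chain.  The
length of the detour is linear in `D`, so that the geodesic is logarithmically close from it, and
only the part of the detour that belongs to the chain can be that close. -/
theorem exists_within_of_isShadowed (H : IsLinHypSpace X A) (hA : 1 ≤ A) {T γ c : ℝ} (hT : 0 ≤ T)
    (hγ : 0 ≤ γ) : ∃ D₀ : ℕ, ∀ D : ℕ, D₀ ≤ D → ∀ {x : ℕ → X} {n : ℕ} {g : ℝ → X} {ℓ : ℝ},
      IsQGChain x n T γ c → IsGeo g ℓ (x 0) (x n) → IsShadowed x n g ℓ (D + 1) →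
      ∀ s, 0 ≤ s → s ≤ ℓ → ∃ i ≤ n, Within (x i) (g s) D := by
  obtain ⟨C, hC, hC'⟩ := H.exists_within_of_triangle hA
  obtain ⟨B, hB, hB'⟩ := H.exists_within_chain hA
  -- the linear bound for the number of steps of the detour
  obtain ⟨D₁, hD₁⟩ := exists_pow_bound (γ * (4 + 2 * A + A))
    (γ * (4 + 2 * (A * (A + 2) + A + 1) + 3 * A) + c) B (2 * C + T) hB
  refine ⟨D₁ + ⌈2 * C + loss A (2 * C)⌉₊, ?_⟩
  intro D hD x n g ℓ hx hg hsh s hs hs'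
  obtain ⟨k, hk, hkD⟩ := hD₁ D (by omega)
  have hDl : 2 * C + loss A (2 * C) ≤ D := by
    refine (Nat.le_ceil _).trans ?_
    exact_mod_cast (by omega : ⌈2 * C + loss A (2 * C)⌉₊ ≤ D)
  have hl := loss_nonneg hA (by positivity : 0 ≤ 2 * C)
  have hD0 : (0 : ℝ) ≤ D := by positivity
  set D' : ℝ := D + 1 with hD'
  -- the point where the detour ends
  obtain ⟨b, hsb, hbl, hb2, v, hv, hvb, hvb'⟩ : ∃ b, s ≤ b ∧ b ≤ ℓ ∧ b ≤ s + 2 * D' ∧ ∃ v ≤ n,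
      Within (x v) (g b) D' ∧ (s + 2 * D' ≤ b ∨ x v = g b) := by
    by_cases h : ℓ ≤ s + 2 * D'
    · exact ⟨ℓ, hs', le_rfl, h, n, le_rfl, by
        rw [hg.right]; exact Within.refl _ (by linarith), Or.inr hg.right.symm⟩
    · obtain ⟨v, hv, hW⟩ := (hsh (s + 2 * D') (by linarith) (by linarith)).1
      exact ⟨s + 2 * D', by linarith, by linarith, le_rfl, v, hv, hW, Or.inl le_rfl⟩
  -- the point where the detour starts
  obtain ⟨a, ha0, has, j, hj, hW, hja, hvj⟩ : ∃ a, 0 ≤ a ∧ a ≤ s ∧ ∃ j ≤ v, Within (g a) (x j) D' ∧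
      (a + 2 * D' ≤ s ∨ g a = x j) ∧
      (v : ℝ) - j ≤ γ * (4 * D' + 2 * loss A D' + A * (D' + 2)) + c := by
    have hl' := loss_nonneg hA (by linarith : 0 ≤ D')
    by_cases h : s ≤ 2 * D'
    · refine ⟨0, le_rfl, hs, 0, Nat.zero_le _, ?_, Or.inr hg.left, ?_⟩
      · rw [hg.left]; exact Within.refl _ (by linarith)
      · have h1 := hx.quasi 0 v (Nat.zero_le _) hv
        have h2 := H.rdist_le_of_within' hA hvb (hg.within_left (by linarith) hbl).1
          (hx.chain.reach (Nat.zero_le _) hv)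
        rw [hg.rdist_left (by linarith) hbl] at h2
        refine h1.trans ?_
        have : 0 ≤ A * (D' + 2) := by positivity
        gcongr
        linarith
    · obtain ⟨a, ha0, has, j, hj, hW, hvj⟩ := H.exists_left_anchor hA hγ hx hg (by linarith) hsh
        (u := s - 2 * D') (by linarith) (by linarith) hbl hv hvb
      refine ⟨a, ha0, by linarith, j, hj, hW, Or.inl (by linarith), hvj.trans ?_⟩
      gcongr
      linarith
  have hvj' : v - j ≤ 2 ^ k := by
    have : ((v - j : ℕ) : ℝ) ≤ 2 ^ k := by
      rw [Nat.cast_sub hj]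
      refine hvj.trans (le_trans (le_of_eq ?_) hk)
      rw [hD', loss]; ring
    exact_mod_cast this
  have hgs := hg.sub ha0 (has.trans hsb) hbl
  obtain ⟨p, hp⟩ := H.exists_geo (g a) (x j) hW.1
  have hjv := hx.chain.reach hj hv
  obtain ⟨q, hq⟩ := H.exists_geo (x j) (g b) (hjv.trans hvb.1)
  obtain ⟨q₁, hq₁⟩ := H.exists_geo (x j) (x v) hjv
  obtain ⟨q₂, hq₂⟩ := H.exists_geo (x v) (g b) hvb.1
  have hpl := hW.2
  have hql := hvb.2
  have hkB : 0 ≤ B * k := by positivity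
  -- the detour consists of `p`, the chain between `x j` and `x v`, and `q₂`
  rcases hC' hp hq hgs (s - a) (by linarith) (by linarith) with ⟨t, ht, ht', hWt⟩ | ⟨t, ht, ht', hWt⟩
  · simp only [add_sub_cancel] at hWt
    rcases hja with hja | hja
    · -- `g s` is too far from the starting point of `p` to be close from `p`
      exfalso
      have h1 := ((hp.within_left ht ht').trans hWt).2
      rw [hg.rdist_eq a s ha0 has hs'] at h1
      linarith
    · rw [← hja, rdist_self] at ht'
      have : t = 0 := le_antisymm ht' ht
      rw [this, hp.left, hja] at hWt
      exact ⟨j, hj.trans hv, hWt.mono (by linarith)⟩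
  simp only [add_sub_cancel] at hWt
  rcases hC' hq₁ hq₂ hq t ht ht' with ⟨t', ht0, ht1, hWt'⟩ | ⟨t', ht0, ht1, hWt'⟩
  · obtain ⟨i, hi, hWi⟩ := hB' hT k (x := fun i => x (j + i)) (n := v - j) hvj'
      (fun i hi => hx.chain (j + i) (by omega))
      (by simpa [show j + (v - j) = v by omega] using hq₁) t' ht0 ht1
    exact ⟨j + i, by omega, ((hWi.trans hWt').trans hWt).mono (by linarith)⟩
  · have hW2 := hWt'.trans hWt
    rcases hvb' with hvb' | hvb'
    · -- the end point of `q₂` is too far from `g s` for `q₂` to come close to `g s`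
      exfalso
      have h1 := H.rdist_le_of_within hA (hW2.mono (by linarith : C + C ≤ 2 * C))
        (hq₂.within_right ht0 ht1).1 (hg.within hs hsb hbl).1
      rw [hg.rdist_eq s b hs hsb hbl, hq₂.rdist_right ht0 ht1] at h1
      linarith
    · rw [← hvb', rdist_self] at ht1
      have : t' = 0 := le_antisymm ht1 ht0
      rw [this, hq₂.left] at hW2
      exact ⟨v, hv, hW2.mono (by linarith)⟩

/-- Stability of quasi-geodesics: a geodesic lies uniformly close from and to each quasi-geodesic
chain with the same end points.  This holds for some distance that depends on the chain, and large
distances can be decreased one by one. -/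
theorem isShadowed_of_isQGChain (H : IsLinHypSpace X A) (hA : 1 ≤ A) {T γ c : ℝ} (hT : 0 ≤ T)
    (hγ : 0 ≤ γ) : ∃ κ, 0 ≤ κ ∧ ∀ {x : ℕ → X} {n : ℕ} {g : ℝ → X} {ℓ : ℝ},
      IsQGChain x n T γ c → IsGeo g ℓ (x 0) (x n) → IsShadowed x n g ℓ κ := by
  obtain ⟨D₁, hD₁⟩ := H.exists_within_of_isShadowed hA (c := c) hT hγ
  obtain ⟨D₂, hD₂⟩ := H.op.exists_within_of_isShadowed hA (c := c) hT hγ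
  refine ⟨(D₁ + D₂ : ℕ), by positivity, ?_⟩
  intro x n g ℓ hx hg
  have step : ∀ D : ℕ, D₁ + D₂ ≤ D → IsShadowed x n g ℓ (D + 1 : ℕ) → IsShadowed x n g ℓ D := by
    intro D hD hsh s hs hs'
    rw [Nat.cast_add, Nat.cast_one] at hsh
    refine ⟨hD₁ D (by omega) hx hg hsh s hs hs', ?_⟩
    obtain ⟨i, hi, hW⟩ := hD₂ D (by omega) hx.op (by simpa using hg.op) hsh.op
      (ℓ - s) (by linarith) (by linarith)
    simp only [sub_sub_cancel] at hW
    exact ⟨n - i, by omega, hW⟩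
  have start : IsShadowed x n g ℓ ⌈ℓ⌉₊ := by
    intro s hs hs'
    have := Nat.le_ceil ℓ
    exact ⟨⟨0, Nat.zero_le _, (hg.within_left hs hs').mono (by linarith)⟩,
      n, le_rfl, (hg.within_right hs hs').mono (by linarith)⟩
  have start' : IsShadowed x n g ℓ (D₁ + D₂ + ⌈ℓ⌉₊ : ℕ) := by
    intro s hs hs'
    have hle : ((⌈ℓ⌉₊ : ℕ) : ℝ) ≤ (D₁ + D₂ + ⌈ℓ⌉₊ : ℕ) := by exact_mod_cast Nat.le_add_left _ _
    obtain ⟨⟨i, hi, hW⟩, j, hj, hW'⟩ := start s hs hs'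
    exact ⟨⟨i, hi, hW.mono hle⟩, j, hj, hW'.mono hle⟩
  have descend : ∀ m : ℕ, IsShadowed x n g ℓ (D₁ + D₂ + m : ℕ) →
      IsShadowed x n g ℓ (D₁ + D₂ : ℕ) := by
    intro m
    induction m with
    | zero => exact id
    | succ m ih => exact fun h => ih (step _ (Nat.le_add_right _ _) h)
  exact descend _ start'

/-- Conversely, a quasi-geodesic chain lies uniformly close from each geodesic with the same end
points. -/
theorem exists_within_of_isQGChain (H : IsLinHypSpace X A) (hA : 1 ≤ A) {T γ c : ℝ} (hT : 0 ≤ T)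
    (hγ : 0 ≤ γ) : ∃ κ, ∀ {x : ℕ → X} {n : ℕ} {g : ℝ → X} {ℓ : ℝ},
      IsQGChain x n T γ c → IsGeo g ℓ (x 0) (x n) → ∀ i ≤ n,
      ∃ s, 0 ≤ s ∧ s ≤ ℓ ∧ Within (g s) (x i) κ := by
  obtain ⟨κ, hκ, hsh⟩ := H.isShadowed_of_isQGChain hA (c := c) hT hγ
  refine ⟨κ + (γ * (A * (κ + 1 + 1)) + |c|) * T, ?_⟩
  intro x n g ℓ hx hg m hm
  have hsh := hsh hx hg
  have hc := le_abs_self c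
  have hc0 := abs_nonneg c
  have hpos : 0 ≤ (γ * (A * (κ + 1 + 1)) + |c|) * T := by positivity
  by_cases hℓS : ∃ j ≤ m, Within (g ℓ) (x j) κ
  · obtain ⟨j, hj, hW⟩ := hℓS
    -- then `x m` lies between `x j` and the end point `x n`, which are close from that end point
    refine ⟨ℓ, hg.length_nonneg, le_rfl, ?_⟩
    have h0 : Within (g ℓ) (x n) (κ + 1) := by rw [hg.right]; exact Within.refl _ (by linarith)
    have h1 := H.out_bound (hW.mono (by linarith)) h0 (hx.chain.reach (hj.trans hm) le_rfl)
    have h2 := hx.quasi j n (hj.trans hm) le_rfl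
    have h3 : (m : ℝ) ≤ n := by exact_mod_cast hm
    refine (hW.trans (hx.chain.within hj hm)).mono ?_
    gcongr
    nlinarith [mul_le_mul_of_nonneg_left h1 hγ]
  obtain ⟨a, a', ha0, haa, hal', ha1, ⟨j, hj, hW⟩, ha'⟩ :=
    exists_jump (p := fun a => ∃ j ≤ m, Within (g a) (x j) κ) hg.length_nonneg
      ⟨0, Nat.zero_le _, by rw [hg.left]; exact Within.refl _ hκ⟩ hℓS
  have hal := haa.trans hal'
  -- the points of the chain close from `g a` and `g a'` lie on different sides of `x m`
  obtain ⟨j', hj', hW'⟩ := (hsh a' (by linarith) hal').2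
  have hmj : m < j' := by
    by_contra! hle
    exact ha' ⟨j', hle, hW'⟩
  refine ⟨a, ha0, hal, ?_⟩
  have h1 := H.out_bound (hW.mono (by linarith : κ ≤ κ + 1))
    (((hg.within ha0 haa hal').trans hW').mono (by linarith))
    (hx.chain.reach (hj.trans hmj.le) hj')
  have h2 := hx.quasi j j' (hj.trans hmj.le) hj'
  have h3 : (m : ℝ) ≤ j' := by exact_mod_cast hmj.le
  refine (hW.trans (hx.chain.within hj hm)).mono ?_
  gcongr
  nlinarith [mul_le_mul_of_nonneg_left h1 hγ]

end IsHypSpace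

/-! ### Quasi-geodesic sequences and their order -/

/-- A quasi-geodesic sequence, the discrete version of a quasi-geodesic ray.  The discrete version
of an anti-ray is a quasi-geodesic sequence in the opposite space. -/
structure IsQGSeq (e : ℕ → X) (T γ c : ℝ) : Prop where
  step_nonneg : 0 ≤ T
  factor_nonneg : 0 ≤ γ
  step : ∀ i, Within (e i) (e (i + 1)) T
  quasi : ∀ i j : ℕ, i ≤ j → (j : ℝ) - i ≤ γ * rdist (e i) (e j) + c

theorem IsQGSeq.qgChain {e : ℕ → X} {T γ c : ℝ} (h : IsQGSeq e T γ c) (a n : ℕ) :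
    IsQGChain (fun i => e (a + i)) n T γ c where
  chain i _ := h.step (a + i)
  quasi i j hij _ := by
    have := h.quasi (a + i) (a + j) (by omega)
    push_cast at this
    linarith

theorem IsQGSeq.within {e : ℕ → X} {T γ c : ℝ} (h : IsQGSeq e T γ c) {i j : ℕ} (hij : i ≤ j) :
    Within (e i) (e j) (((j : ℝ) - i) * T) :=
  IsChain.within (n := j) (fun i _ => h.step i) hij le_rfl

/-- The sequence is quasi-geodesic in the space or in its opposite. -/
def IsEndSeq (e : ℕ → X) : Prop :=
  (∃ T γ c, IsQGSeq e T γ c) ∨ ∃ T γ c, IsQGSeq (X := Op X) e T γ c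

theorem IsEndSeq.op {e : ℕ → X} (h : IsEndSeq e) : IsEndSeq (X := Op X) e := Or.symm h

/-- The order on sequences: there are pairs of arbitrarily late points of `u` and `v` at bounded
distance. -/
def SeqLE (u v : ℕ → X) : Prop :=
  ∃ M : ℝ, ∀ N : ℕ, ∃ i ≥ N, ∃ j ≥ N, Within (u i) (v j) M

theorem SeqLE.op {u v : ℕ → X} (h : SeqLE u v) : SeqLE (X := Op X) v u := by
  obtain ⟨M, hM⟩ := h
  refine ⟨M, fun N => ?_⟩
  obtain ⟨i, hi, j, hj, hW⟩ := hM N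
  exact ⟨j, hj, i, hi, hW⟩

/-- The sequence leaves all balls, and its initial segments lie within bounded distance from and to
some point. -/
structure IsProperSeq (e : ℕ → X) : Prop where
  leaves_out : ∀ x r, ∃ N : ℕ, ∀ i, N ≤ i → ¬ Within x (e i) r
  leaves_in : ∀ x r, ∃ N : ℕ, ∀ i, N ≤ i → ¬ Within (e i) x r
  within_from : ∀ N : ℕ, ∃ b C, ∀ i < N, Within b (e i) C
  within_to : ∀ N : ℕ, ∃ b C, ∀ i < N, Within (e i) b C

theorem IsProperSeq.op {e : ℕ → X} (h : IsProperSeq e) : IsProperSeq (X := Op X) e :=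
  ⟨h.leaves_in, h.leaves_out, h.within_to, h.within_from⟩

namespace IsHypSpace

variable {A : ℝ}

/-- By (B1) and (B2), a ball contains only boundedly many points of a quasi-geodesic sequence. -/
theorem isProperSeq_of_isQGSeq {δ : ℝ} {φ : ℝ → ℝ} (H : IsHypSpace X δ φ) {e : ℕ → X}
    {T γ c : ℝ} (h : IsQGSeq e T γ c) : IsProperSeq e where
  leaves_out x r := by
    by_contra! hcon
    obtain ⟨i, -, hi⟩ := hcon 0
    obtain ⟨j, hj, hj'⟩ := hcon (i + (⌈γ * φ r + c⌉₊ + 1))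
    have h1 := H.out_bound hi hj' (h.within (by omega)).1
    have h2 := h.quasi i j (by omega)
    have h3 := Nat.le_ceil (γ * φ r + c)
    have h4 : (i : ℝ) + (⌈γ * φ r + c⌉₊ + 1) ≤ j := by exact_mod_cast hj
    have := mul_le_mul_of_nonneg_left h1 h.factor_nonneg
    linarith
  leaves_in x r := by
    by_contra! hcon
    obtain ⟨i, -, hi⟩ := hcon 0
    obtain ⟨j, hj, hj'⟩ := hcon (i + (⌈γ * φ r + c⌉₊ + 1))
    have h1 := H.in_bound hi hj' (h.within (by omega)).1
    have h2 := h.quasi i j (by omega)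
    have h3 := Nat.le_ceil (γ * φ r + c)
    have h4 : (i : ℝ) + (⌈γ * φ r + c⌉₊ + 1) ≤ j := by exact_mod_cast hj
    have := mul_le_mul_of_nonneg_left h1 h.factor_nonneg
    linarith
  within_from N := by
    refine ⟨e 0, N * T, fun i hi => (h.within (Nat.zero_le i)).mono ?_⟩
    have hi' : (i : ℝ) ≤ N := by exact_mod_cast hi.le
    have := h.step_nonneg
    simp only [Nat.cast_zero, sub_zero]
    gcongr
  within_to N := by
    refine ⟨e N, N * T, fun i hi => (h.within hi.le).mono ?_⟩
    have hi' : (0 : ℝ) ≤ i := by positivity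
    have := h.step_nonneg
    gcongr
    linarith

theorem isProperSeq {δ : ℝ} {φ : ℝ → ℝ} (H : IsHypSpace X δ φ) {e : ℕ → X} (h : IsEndSeq e) :
    IsProperSeq e := by
  rcases h with ⟨T, γ, c, h⟩ | ⟨T, γ, c, h⟩
  · exact H.isProperSeq_of_isQGSeq h
  · exact (H.op.isProperSeq_of_isQGSeq h).op

/-- If `u ≤ v` for quasi-geodesic sequences `u` and `v`, then the late points of `v` are uniformly
close from `u`.  Two connections from `u` to `v` form a quadrilateral together with `u` and `v`;
the point of `v` in question is close from the diagonal, which starts in `u`, and thereby from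
`u`. -/
theorem exists_within_of_seqLE_of_isQGSeq (H : IsLinHypSpace X A) (hA : 1 ≤ A) {u v : ℕ → X}
    {T γ c T' γ' c' : ℝ} (hu : IsQGSeq u T γ c) (hv : IsQGSeq v T' γ' c') (huv : SeqLE u v) :
    ∃ C, ∃ N : ℕ, ∀ m, N ≤ m → ∃ i, Within (u i) (v m) C := by
  obtain ⟨M, hM⟩ := huv
  obtain ⟨i₀, -, j₀, -, hW₀⟩ := hM 0
  have hM0 := hW₀.nonneg
  have hT' := hv.step_nonneg
  have hγ' := hv.factor_nonneg
  obtain ⟨B, hB, hB'⟩ := H.exists_within_of_triangle hA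
  obtain ⟨κ, hκ, hκ'⟩ := H.isShadowed_of_isQGChain hA (c := c) hu.step_nonneg hu.factor_nonneg
  obtain ⟨κ', hκ''⟩ := H.exists_within_of_isQGChain hA (T := M + T')
    (c := γ' * loss A M + |c'| + 1) (by linarith) hγ'
  have hl := loss_nonneg hA hM0
  have hc' := le_abs_self c'
  have hc0 := abs_nonneg c'
  refine ⟨κ + M + B + κ', j₀, fun m hm => ?_⟩
  obtain ⟨i₁, hi₁, j₁, hj₁, hW₁⟩ := hM (i₀ + m)
  -- prefix the tail of `v` by `u i₀`
  set w : ℕ → X := fun n => if n = 0 then u i₀ else v (j₀ + (n - 1)) with hw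
  have hw0 : w 0 = u i₀ := by simp [hw]
  have hws : ∀ n, w (n + 1) = v (j₀ + n) := fun n => by simp [hw]
  have hwc : IsQGChain w (j₁ - j₀ + 1) (M + T') γ' (γ' * loss A M + |c'| + 1) := by
    constructor
    · intro i _
      cases i with
      | zero =>
        rw [hw0, hws]
        exact hW₀.mono (by linarith)
      | succ i =>
        rw [hws, hws]
        exact (hv.step (j₀ + i)).mono (by linarith)
    · intro i j hij _
      have hlγ := mul_nonneg hγ' hl
      cases j with
      | zero =>
        obtain rfl : i = 0 := by omega
        simp only [sub_self, rdist_self]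
        linarith
      | succ j =>
        cases i with
        | zero =>
          rw [hw0, hws]
          have h1 := hv.quasi j₀ (j₀ + j) (by omega)
          have hr := (hv.within (show j₀ ≤ j₀ + j by omega)).1
          have h2 := H.rdist_le_of_within hA hW₀ (hW₀.1.trans hr) hr
          have h3 := mul_le_mul_of_nonneg_left h2 hγ'
          push_cast at h1 ⊢
          linarith
        | succ i =>
          rw [hws, hws]
          have h1 := hv.quasi (j₀ + i) (j₀ + j) (by omega)
          push_cast at h1 ⊢
          linarith
  have hii : i₀ ≤ i₁ := by omega
  have hend : w (j₁ - j₀ + 1) = v j₁ := by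
    rw [hws]; congr 1; omega
  have hr₁ := (hu.within hii).1
  obtain ⟨g, hg⟩ := H.exists_geo (u i₀) (v j₁) (hr₁.trans hW₁.1)
  obtain ⟨h, hh⟩ := H.exists_geo (u i₀) (u i₁) hr₁
  obtain ⟨k, hk⟩ := H.exists_geo (u i₁) (v j₁) hW₁.1
  obtain ⟨s, hs, hs', hWs⟩ := hκ'' hwc (by rw [hw0, hend]; exact hg) (m - j₀ + 1) (by omega)
  rw [hws, show j₀ + (m - j₀) = m by omega] at hWs
  rcases hB' hh hk hg s hs hs' with ⟨t, ht, ht', hWt⟩ | ⟨t, ht, ht', hWt⟩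
  · obtain ⟨i, -, hWi⟩ := (hκ' (hu.qgChain i₀ (i₁ - i₀))
      (by simpa [show i₀ + (i₁ - i₀) = i₁ by omega] using hh) t ht ht').1
    exact ⟨i₀ + i, ((hWi.trans hWt).trans hWs).mono (by linarith)⟩
  · exact ⟨i₁, (((hk.within_left ht ht').trans hWt).trans hWs).mono
      (by linarith [hW₁.2])⟩

/-- If `u ≤ v`, where `v` is quasi-geodesic and `u` is quasi-geodesic in the opposite space, then
the late points of `v` are uniformly close from `u`. -/
theorem exists_within_of_seqLE_of_isQGSeq_op (H : IsLinHypSpace X A) (hA : 1 ≤ A) {u v : ℕ → X}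
    {T γ c T' γ' c' : ℝ} (hu : IsQGSeq (X := Op X) u T γ c) (hv : IsQGSeq v T' γ' c')
    (huv : SeqLE u v) :
    ∃ C, ∃ N : ℕ, ∀ m, N ≤ m → ∃ i, Within (u i) (v m) C := by
  obtain ⟨M, hM⟩ := huv
  obtain ⟨i₀, -, j₀, -, hW₀⟩ := hM 0
  have hM0 := hW₀.nonneg
  have hT' := hv.step_nonneg
  have hγ' := hv.factor_nonneg
  obtain ⟨B, hB, hB'⟩ := H.exists_within_of_triangle hA
  obtain ⟨κ, hκ, hκ'⟩ := H.op.isShadowed_of_isQGChain hA (c := c) hu.step_nonneg hu.factor_nonneg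
  obtain ⟨κ', hκ''⟩ := H.exists_within_of_isQGChain hA (c := c') hT' hγ'
  refine ⟨κ + M + B + A + κ', j₀, fun m hm => ?_⟩
  -- the second connection has to reach `v` so late that `v m` is not close to it
  set R : ℝ := |κ'| + A + M with hR
  set K : ℕ := ⌈γ' * (A * (R + 1)) + c'⌉₊ + 1 with hK
  obtain ⟨i₁, hi₁, j₁, hj₁, hW₁⟩ := hM (i₀ + m + K)
  have hii : i₀ ≤ i₁ := by omega
  have hr₁ : Reach (u i₁) (u i₀) := (hu.within hii).1
  obtain ⟨g, hg⟩ := H.exists_geo (v j₀) (v j₁) (hv.within (by omega)).1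
  obtain ⟨q, hq⟩ := H.exists_geo (u i₁) (v j₀) (hr₁.trans hW₀.1)
  obtain ⟨h, hh⟩ := H.exists_geo (u i₁) (u i₀) hr₁
  obtain ⟨h₀, hh₀⟩ := H.exists_geo (u i₀) (v j₀) hW₀.1
  obtain ⟨k, hk⟩ := H.exists_geo (u i₁) (v j₁) hW₁.1
  obtain ⟨s, hs, hs', hWs⟩ := hκ'' (hv.qgChain j₀ (j₁ - j₀))
    (by simpa [show j₀ + (j₁ - j₀) = j₁ by omega] using hg) (m - j₀) (by omega)
  rw [show j₀ + (m - j₀) = m by omega] at hWs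
  have hκ0 := hWs.nonneg
  rcases H.thin hg (Or.inr hq) (Or.inr hk) s hs hs' with ⟨t, ht, ht', hWt⟩ | ⟨t, ht, ht', hWt⟩
  · rcases hB' hh hh₀ hq t ht ht' with ⟨t', h0, h1, hWt'⟩ | ⟨t', h0, h1, hWt'⟩
    · obtain ⟨i, -, hWi⟩ := (hκ' (hu.qgChain i₀ (i₁ - i₀))
        (by simpa [show i₀ + (i₁ - i₀) = i₁ by omega] using hh.op)
        (rdist (u i₁) (u i₀) - t') (by linarith) (by linarith)).2
      simp only [sub_sub_cancel] at hWi
      have hWi : Within (u (i₀ + i)) (h t') κ := hWi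
      exact ⟨i₀ + i, (((hWi.trans hWt').trans hWt).trans hWs).mono (by linarith)⟩
    · exact ⟨i₀, ((((hh₀.within_left h0 h1).trans hWt').trans hWt).trans hWs).mono
        (by linarith [hW₀.2])⟩
  · exfalso
    have h1 := (hWt.trans (hk.within_right ht ht')).mono
      (by linarith [hW₁.2, abs_nonneg κ'] : A + (rdist (u i₁) (v j₁) - t) ≤ R)
    have h2 := H.out_bound (hWs.mono (by linarith [le_abs_self κ'] : κ' ≤ R)) h1
      (hv.within (by omega)).1
    have h3 := hv.quasi m j₁ (by omega)
    have h4 := Nat.le_ceil (γ' * (A * (R + 1)) + c')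
    have h5 : (m : ℝ) + (⌈γ' * (A * (R + 1)) + c'⌉₊ + 1) ≤ j₁ := by
      exact_mod_cast (by omega : m + (⌈γ' * (A * (R + 1)) + c'⌉₊ + 1) ≤ j₁)
    have := mul_le_mul_of_nonneg_left h2 hγ'
    linarith

theorem seqLE_trans_of_isQGSeq (H : IsLinHypSpace X A) (hA : 1 ≤ A) {u v w : ℕ → X} {T γ c : ℝ}
    (hu : IsEndSeq u) (hv : IsQGSeq v T γ c) (huv : SeqLE u v) (hvw : SeqLE v w) :
    SeqLE u w := by
  have hC : ∃ C, ∃ N : ℕ, ∀ m, N ≤ m → ∃ i, Within (u i) (v m) C := by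
    rcases hu with ⟨T', γ', c', hu⟩ | ⟨T', γ', c', hu⟩
    · exact H.exists_within_of_seqLE_of_isQGSeq hA hu hv huv
    · exact H.exists_within_of_seqLE_of_isQGSeq_op hA hu hv huv
  obtain ⟨C, N₀, hC⟩ := hC
  obtain ⟨M, hM⟩ := hvw
  refine ⟨C + M, fun N => ?_⟩
  obtain ⟨b, C', hb⟩ := (H.isProperSeq hu).within_from N
  obtain ⟨N₁, hN₁⟩ := (H.isProperSeq_of_isQGSeq hv).leaves_out b (C' + C)
  obtain ⟨m, hm, j, hj, hW⟩ := hM (N + N₀ + N₁)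
  obtain ⟨i, hi⟩ := hC m (by omega)
  refine ⟨i, ?_, j, by omega, hi.trans hW⟩
  by_contra! hlt
  exact hN₁ m (by omega) ((hb i hlt).trans hi)

/-- The order on quasi-geodesic sequences of both directions is transitive. -/
theorem seqLE_trans (H : IsLinHypSpace X A) (hA : 1 ≤ A) {u v w : ℕ → X}
    (hu : IsEndSeq u) (hv : IsEndSeq v) (hw : IsEndSeq w) (huv : SeqLE u v) (hvw : SeqLE v w) :
    SeqLE u w := by
  rcases hv with ⟨T, γ, c, hv⟩ | ⟨T, γ, c, hv⟩
  · exact H.seqLE_trans_of_isQGSeq hA hu hv huv hvw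
  · exact SeqLE.op (X := Op X) (H.op.seqLE_trans_of_isQGSeq hA hw.op hv hvw.op huv.op)

end IsHypSpace

/-- The order depends on sequences only up to bounded distance. -/
theorem SeqLE.of_within {u v u' v' : ℕ → X} (hu : IsProperSeq u) (hv : IsProperSeq v)
    (hu' : IsProperSeq u') (hv' : IsProperSeq v') {K : ℝ} (huu : ∀ i, ∃ k, Within (u' k) (u i) K)
    (hvv : ∀ j, ∃ l, Within (v j) (v' l) K) (h : SeqLE u v) : SeqLE u' v' := by
  obtain ⟨M, hM⟩ := h
  refine ⟨K + M + K, fun N => ?_⟩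
  obtain ⟨b, C, hb⟩ := hu'.within_from N
  obtain ⟨N₁, hN₁⟩ := hu.leaves_out b (C + K)
  obtain ⟨b', C', hb'⟩ := hv'.within_to N
  obtain ⟨N₂, hN₂⟩ := hv.leaves_in b' (K + C')
  obtain ⟨i, hi, j, hj, hW⟩ := hM (N₁ + N₂)
  obtain ⟨k, hk⟩ := huu i
  obtain ⟨l, hl⟩ := hvv j
  refine ⟨k, ?_, l, ?_, (hk.trans hW).trans hl⟩
  · by_contra! hlt
    exact hN₁ i (by omega) ((hb k hlt).trans hk)
  · by_contra! hlt
    exact hN₂ j (by omega) (hl.trans (hb' l hlt))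

/-! ### Directed paths and their lengths -/

open Topology in
theorem nhds_forwardTopology_directedDist (t : ℝ) :
    @nhds ℝ (forwardTopology directedDist) t = 𝓝[≥] t := by
  rw [TopologicalSpace.nhds_generateFrom]
  apply le_antisymm
  · intro s hs
    obtain ⟨u, hu, hus⟩ := mem_nhdsGE_iff_exists_Ico_subset.1 hs
    have hu : t < u := hu
    refine mem_of_superset (mem_iInf_of_mem {y | directedDist t y < (u - t).toNNReal}
      (mem_iInf_of_mem ⟨?_, t, _, rfl⟩ (mem_principal_self _))) ?_
    swap
    · change directedDist t t < _
      simp [directedDist, hu]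
    · intro y hy
      apply hus
      have hy : directedDist t y < (u - t).toNNReal := hy
      unfold directedDist at hy
      split_ifs at hy with h
      · have : y - t < u - t := (ENNReal.ofReal_lt_ofReal_iff (by linarith)).1 hy
        exact ⟨h, by linarith⟩
      · simp at hy
  · refine le_iInf₂ fun s hs => ?_
    obtain ⟨hts, x, r, rfl⟩ := hs
    rw [le_principal_iff]
    have ht : directedDist x t < r := hts
    unfold directedDist at ht
    split_ifs at ht with h
    · have hlt : t < x + r := by
        rw [← ENNReal.ofReal_coe_nnreal, ENNReal.ofReal_lt_ofReal_iff_of_nonneg (by linarith)] at ht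
        linarith
      filter_upwards [Ico_mem_nhdsGE hlt] with y hy
      have hxy : x ≤ y := h.trans hy.1
      have : y - x < r := by linarith [hy.2]
      change directedDist _ _ < _
      rw [directedDist, if_pos hxy]
      rw [← ENNReal.ofReal_coe_nnreal, ENNReal.ofReal_lt_ofReal_iff_of_nonneg (by linarith)]
      exact this
    · simp at ht

open Topology in
theorem nhds_backwardTopology_directedDist (t : ℝ) :
    @nhds ℝ (backwardTopology directedDist) t = 𝓝[≤] t := by
  rw [TopologicalSpace.nhds_generateFrom]
  apply le_antisymm
  · intro s hs
    obtain ⟨u, hu, hus⟩ := mem_nhdsLE_iff_exists_Ioc_subset.1 hs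
    have hu : u < t := hu
    refine mem_of_superset (mem_iInf_of_mem {y | directedDist y t < (t - u).toNNReal}
      (mem_iInf_of_mem ⟨?_, t, _, rfl⟩ (mem_principal_self _))) ?_
    swap
    · change directedDist t t < _
      simp [directedDist, hu]
    · intro y hy
      apply hus
      have hy : directedDist y t < (t - u).toNNReal := hy
      unfold directedDist at hy
      split_ifs at hy with h
      · have : t - y < t - u := (ENNReal.ofReal_lt_ofReal_iff (by linarith)).1 hy
        exact ⟨by linarith, h⟩
      · simp at hy
  · refine le_iInf₂ fun s hs => ?_
    obtain ⟨hts, x, r, rfl⟩ := hs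
    rw [le_principal_iff]
    have ht : directedDist t x < r := hts
    unfold directedDist at ht
    split_ifs at ht with h
    · have hlt : x - r < t := by
        rw [← ENNReal.ofReal_coe_nnreal, ENNReal.ofReal_lt_ofReal_iff_of_nonneg (by linarith)] at ht
        linarith
      filter_upwards [Ioc_mem_nhdsLE hlt] with y hy
      have hxy : y ≤ x := hy.2.trans h
      have : x - y < r := by linarith [hy.1]
      change directedDist _ _ < _
      rw [directedDist, if_pos hxy]
      rw [← ENNReal.ofReal_coe_nnreal, ENNReal.ofReal_lt_ofReal_iff_of_nonneg (by linarith)]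
      exact this
    · simp at ht

open Topology in
theorem isDirectedOn_iff_eventually {P : ℝ → X} {I : Set ℝ} :
    IsDirectedOn P I ↔ ∀ t ∈ I, ∀ ε : ℝ≥0∞, 0 < ε →
      (∀ᶠ s in 𝓝[≥] t ⊓ 𝓟 I, sd (P t) (P s) < ε) ∧
      (∀ᶠ s in 𝓝[≤] t ⊓ 𝓟 I, sd (P s) (P t) < ε) := by
  have h1 : @ContinuousOn ℝ X (forwardTopology directedDist) (forwardTopology sd) P I ↔
      ∀ t ∈ I, Tendsto P (𝓝[≥] t ⊓ 𝓟 I) (@nhds X (forwardTopology sd) (P t)) := by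
    refine forall₂_congr fun t _ => ?_
    rw [← nhds_forwardTopology_directedDist]
    exact Iff.rfl
  have h2 : @ContinuousOn ℝ X (backwardTopology directedDist) (backwardTopology sd) P I ↔
      ∀ t ∈ I, Tendsto P (𝓝[≤] t ⊓ 𝓟 I) (@nhds X (backwardTopology sd) (P t)) := by
    refine forall₂_congr fun t _ => ?_
    rw [← nhds_backwardTopology_directedDist]
    exact Iff.rfl
  rw [IsDirectedOn, h1, h2]
  simp only [TopologicalSpace.tendsto_nhds_generateFrom_iff]
  constructor
  · rintro ⟨hf, hb⟩ t ht ε hε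
    obtain ⟨r, hr0, hr⟩ := ENNReal.lt_iff_exists_nnreal_btwn.1 hε
    have hr0 : (0 : ℝ≥0∞) < r := hr0
    constructor
    · filter_upwards [hf t ht _ ⟨P t, r, rfl⟩ (by simpa [sd_self] using hr0)] with s hs
      exact lt_trans hs hr
    · filter_upwards [hb t ht _ ⟨P t, r, rfl⟩ (by simpa [sd_self] using hr0)] with s hs
      exact lt_trans hs hr
  · intro h
    constructor
    · rintro t ht _ ⟨x, r, rfl⟩ hx
      have hx : sd x (P t) < r := hx
      filter_upwards [(h t ht (r - sd x (P t)) (tsub_pos_of_lt hx)).1] with s hs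
      refine lt_of_le_of_lt (sd_triangle x (P s) (P t)) ?_
      rw [add_comm]
      exact lt_tsub_iff_right.1 hs
    · rintro t ht _ ⟨x, r, rfl⟩ hx
      have hx : sd (P t) x < r := hx
      filter_upwards [(h t ht (r - sd (P t) x) (tsub_pos_of_lt hx)).2] with s hs
      exact lt_of_le_of_lt (sd_triangle (P s) x (P t)) (lt_tsub_iff_right.1 hs)

/-- A map is directed if and only if nearby later points are close from, and nearby earlier points
are close to, each of its points. -/
theorem isDirectedOn_iff {P : ℝ → X} {I : Set ℝ} :
    IsDirectedOn P I ↔ ∀ t ∈ I, ∀ ε : ℝ≥0∞, 0 < ε → ∃ η > 0,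
      (∀ s ∈ I, t ≤ s → s < t + η → sd (P t) (P s) < ε) ∧
      (∀ s ∈ I, s ≤ t → t - η < s → sd (P s) (P t) < ε) := by
  rw [isDirectedOn_iff_eventually]
  refine forall₂_congr fun t _ => forall₂_congr fun ε _ => ?_
  simp only [eventually_inf_principal]
  constructor
  · rintro ⟨h1, h2⟩
    obtain ⟨u, hu, hu'⟩ := mem_nhdsGE_iff_exists_Ico_subset.1 h1
    obtain ⟨v, hv, hv'⟩ := mem_nhdsLE_iff_exists_Ioc_subset.1 h2
    have hu : t < u := hu
    have hv : v < t := hv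
    refine ⟨min (u - t) (t - v), lt_min (by linarith) (by linarith), ?_, ?_⟩
    · intro s hs hts hst
      exact hu' ⟨hts, by linarith [min_le_left (u - t) (t - v)]⟩ hs
    · intro s hs hts hst
      exact hv' ⟨by linarith [min_le_right (u - t) (t - v)], hts⟩ hs
  · rintro ⟨η, hη, h1, h2⟩
    constructor
    · filter_upwards [Ico_mem_nhdsGE (show t < t + η by linarith)] with s hs hsI
      exact h1 s hsI hs.1 hs.2
    · filter_upwards [Ioc_mem_nhdsLE (show t - η < t by linarith)] with s hs hsI
      exact h2 s hsI hs.2 hs.1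

theorem IsDirectedOn.mono {P : ℝ → X} {I J : Set ℝ} (h : IsDirectedOn P I) (hJ : J ⊆ I) :
    IsDirectedOn P J := by
  rw [isDirectedOn_iff] at h ⊢
  intro t ht ε hε
  obtain ⟨η, hη, h1, h2⟩ := h t (hJ ht) ε hε
  exact ⟨η, hη, fun s hs => h1 s (hJ hs), fun s hs => h2 s (hJ hs)⟩

theorem sd_le_sum_range (x : ℕ → X) (n : ℕ) :
    sd (x 0) (x n) ≤ ∑ i ∈ Finset.range n, sd (x i) (x (i + 1)) := by
  induction n with
  | zero => simp [sd_self]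
  | succ n ih =>
    rw [Finset.sum_range_succ]
    exact (sd_triangle _ _ (x n)).trans (by gcongr)

/-- The `i`-th point of the subdivision of `[a, b]` into `N` equal pieces. -/
noncomputable def node (a b : ℝ) (N i : ℕ) : ℝ := a + i * (b - a) / N

theorem pathLength_eq (P : ℝ → X) (a b : ℝ) :
    pathLength P a b = limsup (fun N : ℕ => ∑ i ∈ Finset.range N,
      sd (P (node a b N i)) (P (node a b N (i + 1)))) atTop := by
  simp only [pathLength, node, Nat.cast_add, Nat.cast_one]

theorem node_zero (a b : ℝ) (N : ℕ) : node a b N 0 = a := by simp [node]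

theorem node_last (a b : ℝ) {N : ℕ} (hN : 0 < N) : node a b N N = b := by
  have : (N : ℝ) ≠ 0 := by positivity
  unfold node
  field_simp
  ring

theorem node_succ (a b : ℝ) (N i : ℕ) : node a b N (i + 1) = node a b N i + (b - a) / N := by
  simp only [node, Nat.cast_add, Nat.cast_one]; ring

theorem node_mono {a b : ℝ} (hab : a ≤ b) (N : ℕ) : Monotone (node a b N) := by
  refine monotone_nat_of_le_succ fun i => ?_
  rw [node_succ]
  have : 0 ≤ (b - a) / N := div_nonneg (by linarith) (by positivity)
  linarith

theorem node_mem {a b : ℝ} (hab : a ≤ b) {N i : ℕ} (hi : i ≤ N) (hN : 0 < N) :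
    node a b N i ∈ Icc a b := by
  have h := node_mono hab N
  refine ⟨?_, ?_⟩
  · exact (node_zero a b N).symm.le.trans (h (Nat.zero_le i))
  · exact (h hi).trans (node_last a b hN).le

theorem sd_le_pathLength (P : ℝ → X) (a b : ℝ) : sd (P a) (P b) ≤ pathLength P a b := by
  rw [pathLength_eq]
  refine le_limsup_of_frequently_le (Eventually.frequently ?_)
  filter_upwards [eventually_gt_atTop 0] with N hN
  have := sd_le_sum_range (fun i => P (node a b N i)) N
  rwa [node_zero, node_last a b hN] at this

/-- A Lipschitz map (for the directed distance of the real line) is directed. -/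
theorem isDirectedOn_of_lipschitz {P : ℝ → X} {I : Set ℝ} {K : ℝ}
    (h : ∀ s ∈ I, ∀ t ∈ I, s ≤ t → Within (P s) (P t) (K * (t - s))) : IsDirectedOn P I := by
  have h' : ∀ s ∈ I, ∀ t ∈ I, s ≤ t → ∀ ε : ℝ, 0 < ε → t - s < ε / (|K| + 1) →
      sd (P s) (P t) < ENNReal.ofReal ε := by
    intro s hs t ht hst ε hε hlt
    have hK := le_abs_self K
    have hK0 := abs_nonneg K
    rw [lt_div_iff₀ (by positivity)] at hlt
    have hW := h s hs t ht hst
    refine lt_of_le_of_lt ((within_iff hW.nonneg).1 hW) ?_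
    rw [ENNReal.ofReal_lt_ofReal_iff hε]
    nlinarith
  rw [isDirectedOn_iff]
  intro t ht ε hε
  obtain ⟨r, hr0, hr⟩ := ENNReal.lt_iff_exists_nnreal_btwn.1 hε
  have hr0 : (0 : ℝ) < r := by exact_mod_cast hr0
  refine ⟨r / (|K| + 1), by positivity, ?_, ?_⟩
  · intro s hs hts hst
    refine lt_trans (h' t ht s hs hts r hr0 (by linarith)) ?_
    rwa [ENNReal.ofReal_coe_nnreal]
  · intro s hs hts hst
    refine lt_trans (h' s hs t ht hts r hr0 (by linarith)) ?_
    rwa [ENNReal.ofReal_coe_nnreal]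

theorem pathLength_le_of_lipschitz {P : ℝ → X} {a b K : ℝ} (hab : a ≤ b)
    (h : ∀ s ∈ Icc a b, ∀ t ∈ Icc a b, s ≤ t → Within (P s) (P t) (K * (t - s))) :
    pathLength P a b ≤ ENNReal.ofReal (K * (b - a)) := by
  rw [pathLength_eq]
  refine limsup_le_of_le (h := ?_)
  filter_upwards [eventually_gt_atTop 0] with N hN
  have hN' : (0 : ℝ) < N := by exact_mod_cast hN
  have hK := (h a ⟨le_rfl, hab⟩ b ⟨hab, le_rfl⟩ hab).nonneg
  have step : ∀ i ∈ Finset.range N, sd (P (node a b N i)) (P (node a b N (i + 1))) ≤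
      ENNReal.ofReal (K * (b - a) / N) := by
    intro i hi
    have hi : i < N := Finset.mem_range.1 hi
    have hW := h _ (node_mem hab hi.le hN) _ (node_mem hab hi hN)
      (node_mono hab N (Nat.le_succ i))
    rw [node_succ, add_sub_cancel_left, mul_div_assoc'] at hW
    rw [node_succ]
    exact (within_iff hW.nonneg).1 hW
  refine (Finset.sum_le_sum step).trans ?_
  rw [Finset.sum_const, Finset.card_range, nsmul_eq_mul, ← ENNReal.ofReal_natCast,
    ← ENNReal.ofReal_mul hN'.le]
  apply ENNReal.ofReal_le_ofReal
  rw [mul_div_cancel₀ _ hN'.ne']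

/-- The sum of the distances along the part of an equal subdivision that lies below a point `s`
grows, up to a small error, at least by the distance from `P s` to `P t` when `s` is replaced
by `t`. -/
theorem eventually_sum_add_sd_le {P : ℝ → X} {a b : ℝ} (hab : a < b)
    (hP : IsDirectedOn P (Icc a b)) {s t : ℝ} (hs : s ∈ Icc a b) (ht : t ∈ Icc a b) (hst : s ≤ t)
    {ε : ℝ≥0∞} (hε : 0 < ε) :
    ∀ᶠ N : ℕ in atTop, ∑ i ∈ Finset.range ⌊(s - a) * N / (b - a)⌋₊,
        sd (P (node a b N i)) (P (node a b N (i + 1))) + sd (P s) (P t) ≤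
      ∑ i ∈ Finset.range ⌊(t - a) * N / (b - a)⌋₊,
        sd (P (node a b N i)) (P (node a b N (i + 1))) + ε := by
  rcases hst.eq_or_lt with rfl | hst
  · exact Eventually.of_forall fun N => by simp [sd_self]
  rw [isDirectedOn_iff] at hP
  have hε2 : 0 < ε / 2 := ENNReal.half_pos hε.ne'
  obtain ⟨η₁, hη₁, h1, -⟩ := hP s hs _ hε2
  obtain ⟨η₂, hη₂, -, h2⟩ := hP t ht _ hε2
  have hba : 0 < b - a := by linarith
  have hlim : Tendsto (fun N : ℕ => (b - a) / (N : ℝ)) atTop (nhds 0) :=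
    tendsto_const_div_atTop_nhds_zero_nat _
  filter_upwards [hlim.eventually (gt_mem_nhds hη₁), hlim.eventually (gt_mem_nhds hη₂),
    hlim.eventually (gt_mem_nhds (show (0 : ℝ) < t - s by linarith)), eventually_gt_atTop 0]
    with N hN₁ hN₂ hN₃ hN
  have hN' : (0 : ℝ) < N := by exact_mod_cast hN
  have floor_spec : ∀ u ∈ Icc a b, node a b N ⌊(u - a) * N / (b - a)⌋₊ ≤ u ∧
      u < node a b N (⌊(u - a) * N / (b - a)⌋₊ + 1) := by
    intro u hu
    have h0 : 0 ≤ (u - a) * N / (b - a) :=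
      div_nonneg (mul_nonneg (by linarith [hu.1]) hN'.le) hba.le
    have e : u = a + ((u - a) * N / (b - a)) * (b - a) / N := by field_simp; ring
    constructor
    · conv_rhs => rw [e]
      unfold node
      gcongr
      exact Nat.floor_le h0
    · conv_lhs => rw [e]
      unfold node
      gcongr
      exact_mod_cast Nat.lt_floor_add_one _
  set p := ⌊(s - a) * N / (b - a)⌋₊
  set q := ⌊(t - a) * N / (b - a)⌋₊
  obtain ⟨hp, hp'⟩ := floor_spec s hs
  obtain ⟨hq, hq'⟩ := floor_spec t ht
  change node a b N p ≤ s at hp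
  change s < node a b N (p + 1) at hp'
  change node a b N q ≤ t at hq
  change t < node a b N (q + 1) at hq'
  have hmono := node_mono hab.le N
  have hp2 := node_succ a b N p
  have hq2 := node_succ a b N q
  have hpq : p + 1 ≤ q := by
    by_contra! hlt
    have := hmono (show q ≤ p by omega)
    linarith
  have hpt : node a b N (p + 1) ≤ t := (hmono hpq).trans hq
  have hqs : s ≤ node a b N q := hp'.le.trans (hmono hpq)
  have e1 := h1 (node a b N (p + 1)) ⟨hs.1.trans hp'.le, hpt.trans ht.2⟩ hp'.le (by linarith)
  have e2 := h2 (node a b N q) ⟨hs.1.trans hqs, hq.trans ht.2⟩ hq (by linarith)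
  have e3 := sd_le_sum_range (fun i => P (node a b N (p + 1 + i))) (q - (p + 1))
  simp only [add_zero, Nat.add_sub_cancel' hpq] at e3
  rw [← Finset.sum_range_add_sum_Ico _ ((Nat.le_succ p).trans hpq), add_assoc]
  gcongr
  calc sd (P s) (P t)
      ≤ sd (P s) (P (node a b N (p + 1))) + sd (P (node a b N (p + 1))) (P t) := sd_triangle _ _ _
    _ ≤ sd (P s) (P (node a b N (p + 1))) +
        (sd (P (node a b N (p + 1))) (P (node a b N q)) + sd (P (node a b N q)) (P t)) := by
      gcongr; exact sd_triangle _ _ _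
    _ ≤ ε / 2 + (∑ i ∈ Finset.range (q - (p + 1)),
        sd (P (node a b N (p + 1 + i))) (P (node a b N (p + 1 + (i + 1)))) + ε / 2) := by
      gcongr
    _ = ∑ i ∈ Finset.Ico (p + 1) q,
        sd (P (node a b N i)) (P (node a b N (i + 1))) + (ε / 2 + ε / 2) := by
      rw [Finset.sum_Ico_eq_sum_range]
      simp only [add_assoc]
      ring
    _ ≤ _ := by
      rw [ENNReal.add_halves]
      gcongr
      omega

/-- The sum of the distances along any subdivision is at most the length. -/
theorem sum_sd_le_pathLength {P : ℝ → X} {a b : ℝ} (hP : IsDirectedPath P a b) {t : ℕ → ℝ}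
    (k : ℕ) (ht : ∀ i ≤ k, t i ∈ Icc a b) (hmono : ∀ i < k, t i ≤ t (i + 1)) :
    ∑ i ∈ Finset.range k, sd (P (t i)) (P (t (i + 1))) ≤ pathLength P a b := by
  obtain ⟨hab, hP⟩ := hP
  apply ENNReal.le_of_forall_pos_le_add
  intro ε hε _
  have key : ∀ j ≤ k, ∀ᶠ N : ℕ in atTop, ∑ i ∈ Finset.range j, sd (P (t i)) (P (t (i + 1))) ≤
      ∑ i ∈ Finset.range ⌊(t j - a) * N / (b - a)⌋₊,
        sd (P (node a b N i)) (P (node a b N (i + 1))) + j * (ε / (k + 1) : ℝ≥0∞) := by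
    intro j
    induction j with
    | zero => intro _; simp
    | succ j ih =>
      intro hj
      have hε' : (0 : ℝ≥0∞) < ε / (k + 1) := ENNReal.div_pos (by simpa using hε.ne') (by finiteness)
      filter_upwards [ih (by omega), eventually_sum_add_sd_le hab hP (ht j (by omega))
        (ht (j + 1) hj) (hmono j (by omega)) hε'] with N h1 h2
      rw [Finset.sum_range_succ]
      refine (add_le_add_left h1 _).trans ?_
      rw [add_right_comm]
      refine (add_le_add_left h2 _).trans (le_of_eq ?_)
      push_cast
      ring
  rw [pathLength_eq, ← tsub_le_iff_right]
  refine le_limsup_of_frequently_le (Eventually.frequently ?_)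
  filter_upwards [key k le_rfl, eventually_gt_atTop 0] with N h hN
  rw [tsub_le_iff_right]
  refine h.trans (add_le_add (Finset.sum_le_sum_of_subset ?_) ?_)
  · apply Finset.range_subset_range.2
    refine Nat.floor_le_of_le ?_
    rw [div_le_iff₀ (by linarith), mul_comm]
    gcongr
    linarith [(ht k le_rfl).2]
  · calc (k : ℝ≥0∞) * (ε / (k + 1)) ≤ (k + 1) * (ε / (k + 1)) := by gcongr; exact le_self_add
      _ = ε := ENNReal.mul_div_cancel (by simp) (by finiteness)

/-! ### Geodesics parametrized by arc length -/

theorem eq_of_rdist_eq_zero {x y : X} (h : Reach x y) (h0 : rdist x y = 0) : x = y := by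
  rw [← sd_eq_zero_iff]
  exact ((ENNReal.toReal_eq_zero_iff _).1 h0).resolve_right h

theorem rdist_lt_of_sd_lt {x y : X} {ε : ℝ} (h : sd x y < ENNReal.ofReal ε) : rdist x y < ε := by
  have hε : 0 < ε := ENNReal.ofReal_pos.1 (lt_of_le_of_lt zero_le h)
  exact (ENNReal.lt_ofReal_iff_toReal_lt h.ne_top).1 h

/-- A geodesic can be parametrized by arc length, since the distance from its starting point is
continuous along it. -/
theorem IsGeodesic.exists_isGeo {P : ℝ → X} {a b : ℝ} {x y : X} (h : IsGeodesic P a b x y)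
    (hxy : Reach x y) : ∃ g, IsGeo g (rdist x y) x y := by
  obtain ⟨hP, rfl, rfl, hlen⟩ := h
  have hab := hP.1
  have hsum : ∀ s t, a ≤ s → s ≤ t → t ≤ b →
      sd (P a) (P s) + sd (P s) (P t) + sd (P t) (P b) ≤ sd (P a) (P b) := by
    intro s t has hst htb
    rw [← hlen]
    have := sum_sd_le_pathLength hP
      (t := fun i => if i = 0 then a else if i = 1 then s else if i = 2 then t else b) 3
      (by
        intro i hi
        interval_cases i <;> simp only [one_ne_zero, reduceIte, OfNat.ofNat_ne_zero,
          OfNat.ofNat_ne_one, Nat.reduceEqDiff] <;>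
          constructor <;> linarith)
      (by
        intro i hi
        interval_cases i <;> simp <;> linarith)
    simpa [Finset.sum_range_succ] using this
  have hreach : ∀ s t, a ≤ s → s ≤ t → t ≤ b → Reach (P s) (P t) := by
    intro s t has hst htb
    refine ne_top_of_le_ne_top hxy (le_trans ?_ (hsum s t has hst htb))
    exact le_add_right (le_add_left le_rfl)
  set f : ℝ → ℝ := fun t => rdist (P a) (P t) with hf
  have hadd : ∀ s t, a ≤ s → s ≤ t → t ≤ b → f t = f s + rdist (P s) (P t) := by
    intro s t has hst htb
    have r1 := hreach a s le_rfl has (hst.trans htb)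
    have r2 := hreach s t has hst htb
    have r3 := hreach t b (has.trans hst) htb le_rfl
    apply le_antisymm (rdist_triangle r1 r2)
    have h1 := ENNReal.toReal_mono hxy (hsum s t has hst htb)
    rw [ENNReal.toReal_add (ENNReal.add_ne_top.2 ⟨r1, r2⟩) r3, ENNReal.toReal_add r1 r2] at h1
    have h2 := rdist_triangle (r1.trans r2) r3
    simp only [rdist] at h2 ⊢
    linarith
  have hcont : ContinuousOn f (Icc a b) := by
    rw [Metric.continuousOn_iff]
    intro t ht ε hε
    obtain ⟨η, hη, h1, h2⟩ := isDirectedOn_iff.1 hP.2 t ht (ENNReal.ofReal ε) (by simpa)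
    refine ⟨η, hη, fun s hs hst => ?_⟩
    rw [Real.dist_eq, abs_lt] at hst
    rw [Real.dist_eq, abs_lt]
    rcases le_total t s with hts | hts
    · have := rdist_lt_of_sd_lt (h1 s hs hts (by linarith))
      rw [hadd t s ht.1 hts hs.2]
      have := rdist_nonneg (P t) (P s)
      constructor <;> linarith
    · have := rdist_lt_of_sd_lt (h2 s hs hts (by linarith))
      rw [hadd s t hs.1 hts ht.2]
      have := rdist_nonneg (P s) (P t)
      constructor <;> linarith
  have hsurj : ∀ u, 0 ≤ u → u ≤ rdist (P a) (P b) → ∃ t ∈ Icc a b, f t = u := by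
    intro u hu hu'
    have hfa : f a = 0 := rdist_self _
    exact intermediate_value_Icc hab.le hcont ⟨by rw [hfa]; exact hu, hu'⟩
  choose! τ hτ hτf using hsurj
  have main : ∀ s t, 0 ≤ s → s ≤ t → t ≤ rdist (P a) (P b) →
      Reach (P (τ s)) (P (τ t)) ∧ rdist (P (τ s)) (P (τ t)) = t - s := by
    intro s t hs hst ht
    have ms := hτ s hs (hst.trans ht)
    have mt := hτ t (hs.trans hst) ht
    have es := hτf s hs (hst.trans ht)
    have et := hτf t (hs.trans hst) ht
    rcases le_total (τ s) (τ t) with hle | hle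
    · refine ⟨hreach _ _ ms.1 hle mt.2, ?_⟩
      have := hadd _ _ ms.1 hle mt.2
      linarith
    · -- then `s = t`, and `P` does not move between the two parameters
      have h1 := hadd _ _ mt.1 hle ms.2
      have h2 := rdist_nonneg (P (τ t)) (P (τ s))
      have h3 := eq_of_rdist_eq_zero (hreach _ _ mt.1 hle ms.2) (by linarith)
      rw [h3]
      refine ⟨Reach.refl _, ?_⟩
      rw [rdist_self]
      linarith
  have hD := rdist_nonneg (P a) (P b)
  refine ⟨fun u => P (τ u), hD, ?_, ?_, fun s t hs hst ht => (main s t hs hst ht).1,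
    fun s t hs hst ht => (main s t hs hst ht).2⟩
  · have m := hτ 0 le_rfl hD
    exact (eq_of_rdist_eq_zero (hreach a _ le_rfl m.1 m.2) (hτf 0 le_rfl hD)).symm
  · have m := hτ _ hD le_rfl
    have e := hτf _ hD le_rfl
    have := hadd _ _ m.1 m.2 le_rfl
    exact eq_of_rdist_eq_zero (hreach _ b m.1 m.2 le_rfl) (by simp only [hf] at e this; linarith)

/-- The arc-length geodesic, linearly reparametrized on the unit interval. -/
theorem IsGeo.lipschitz_unit {g : ℝ → X} {ℓ : ℝ} {x y : X} (h : IsGeo g ℓ x y) :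
    ∀ s ∈ Icc (0 : ℝ) 1, ∀ t ∈ Icc (0 : ℝ) 1, s ≤ t →
      Within (g (s * ℓ)) (g (t * ℓ)) (ℓ * (t - s)) := by
  intro s hs t ht hst
  have := h.length_nonneg
  refine (h.within (mul_nonneg hs.1 this) (by gcongr) ?_).mono (le_of_eq (by ring))
  nlinarith [ht.2]

theorem IsGeo.isGeodesic {g : ℝ → X} {ℓ : ℝ} {x y : X} (h : IsGeo g ℓ x y) :
    IsGeodesic (fun s => g (s * ℓ)) 0 1 x y := by
  refine ⟨⟨one_pos, isDirectedOn_of_lipschitz h.lipschitz_unit⟩, by simpa using h.left,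
    by simpa using h.right, le_antisymm ?_ ?_⟩
  · refine (pathLength_le_of_lipschitz zero_le_one h.lipschitz_unit).trans (le_of_eq ?_)
    rw [sub_zero, mul_one, ← h.length_eq, rdist, ENNReal.ofReal_toReal h.reach_ends]
  · have := sd_le_pathLength (fun s => g (s * ℓ)) 0 1
    simpa [h.left, h.right] using this

theorem IsGeo.isGeodesicImage {g : ℝ → X} {ℓ : ℝ} {x y : X} (h : IsGeo g ℓ x y) :
    IsGeodesicImage (g '' Icc 0 ℓ) x y := by
  refine ⟨_, 0, 1, h.isGeodesic, ?_⟩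
  have hℓ := h.length_nonneg
  ext p
  constructor
  · rintro ⟨s, hs, rfl⟩
    rcases hℓ.eq_or_lt with h0 | h0
    · refine ⟨0, by simp, ?_⟩
      have : s = 0 := le_antisymm (hs.2.trans h0.symm.le) hs.1
      simp [this]
    · exact ⟨s / ℓ, ⟨div_nonneg hs.1 hℓ, (div_le_one h0).2 hs.2⟩, by simp [h0.ne']⟩
  · rintro ⟨s, hs, rfl⟩
    exact ⟨s * ℓ, ⟨mul_nonneg hs.1 hℓ, by nlinarith [hs.2]⟩, rfl⟩

theorem exists_isHypSpace (hgeod : IsGeodesicSpace X) (hhyp : IsHyperbolic X) (h1 : PropB1 X)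
    (h2 : PropB2 X) : ∃ δ φ, IsHypSpace X δ φ := by
  obtain ⟨δ, hδ⟩ := hhyp
  obtain ⟨φ₁, hφ₁⟩ := h1
  obtain ⟨φ₂, hφ₂⟩ := h2
  refine ⟨δ, fun r => φ₁ r.toNNReal + φ₂ r.toNNReal, ?_, ?_, ?_, ?_⟩
  · intro x y hxy
    obtain ⟨P, a, b, h⟩ := hgeod x y (lt_top_iff_ne_top.2 hxy)
    exact h.exists_isGeo hxy
  · intro x y z g h k ℓ m n hg hh hk s hs hs'
    rcases hδ x y z _ _ _ hg.isGeodesicImage (hh.imp IsGeo.isGeodesicImage IsGeo.isGeodesicImage)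
      (hk.imp IsGeo.isGeodesicImage IsGeo.isGeodesicImage) ⟨s, ⟨hs, hs'⟩, rfl⟩ with
      ⟨_, ⟨t, ht, rfl⟩, hW⟩ | ⟨_, ⟨t, ht, rfl⟩, hW⟩
    · exact Or.inl ⟨t, ht.1, ht.2, within_iff_nnreal.2 hW⟩
    · exact Or.inr ⟨t, ht.1, ht.2, within_iff_nnreal.2 hW⟩
  · intro x y z r hxy hxz hyz
    have hr := hxy.nonneg
    have := (hφ₁ x r.toNNReal y ((within_iff hr).1 hxy) z ((within_iff hr).1 hxz)).resolve_left hyz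
    have h0 : (0 : ℝ) ≤ φ₂ r.toNNReal := NNReal.coe_nonneg _
    have := (within_iff_nnreal.2 this).2
    linarith
  · intro x y z r hyx hzx hyz
    have hr := hyx.nonneg
    have := (hφ₂ x r.toNNReal y ((within_iff hr).1 hyx) z ((within_iff hr).1 hzx)).resolve_left hyz
    have h0 : (0 : ℝ) ≤ φ₁ r.toNNReal := NNReal.coe_nonneg _
    have := (within_iff_nnreal.2 this).2
    linarith

/-! ### Discretization of quasi-geodesic rays -/

/-- A directed map on `[0, ∞)` that leaves the out-ball of radius `1` around `P a` has a first point
beyond which this ball is left; it lies at distance exactly `1` from `P a`. -/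
theorem exists_unit_step {P : ℝ → X} (hP : IsDirectedOn P (Ici 0))
    (hleave : ∀ (x : X) (r : ℝ≥0), ∃ p, ∀ t, 0 ≤ t → p ≤ t → P t ∉ outBall x r) {a : ℝ}
    (ha : 0 ≤ a) : ∃ b, a < b ∧ (∀ u ∈ Icc a b, sd (P a) (P u) ≤ 1) ∧ sd (P a) (P b) = 1 := by
  obtain ⟨p, hp⟩ := hleave (P a) 1
  set S : Set ℝ := {t | a ≤ t ∧ ∀ u ∈ Icc a t, sd (P a) (P u) ≤ 1} with hS
  have haS : a ∈ S := ⟨le_rfl, fun u hu => by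
    rw [le_antisymm hu.2 hu.1, sd_self]; exact zero_le_one⟩
  have hbdd : BddAbove S := by
    refine ⟨max p a, fun t ht => ?_⟩
    by_contra! hlt
    have h1 := (le_max_left p a).trans hlt.le
    exact hp t (ha.trans ht.1) h1 (by simpa [outBall] using ht.2 t ⟨ht.1, le_rfl⟩)
  set b := sSup S with hb
  have hab : a ≤ b := le_csSup hbdd haS
  have hlt : ∀ u, a ≤ u → u < b → sd (P a) (P u) ≤ 1 := by
    intro u hau hub
    obtain ⟨t, ht, hut⟩ := exists_lt_of_lt_csSup ⟨a, haS⟩ hub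
    exact ht.2 u ⟨hau, hut.le⟩
  rw [isDirectedOn_iff] at hP
  have hle : sd (P a) (P b) ≤ 1 := by
    rcases hab.eq_or_lt with h | h
    · rw [← h, sd_self]; exact zero_le_one
    apply ENNReal.le_of_forall_pos_le_add
    intro ε hε _
    obtain ⟨η, hη, -, h2⟩ := hP b (ha.trans hab) ε (by exact_mod_cast hε)
    have hm : max a (b - η / 2) < b := max_lt h (by linarith)
    have h3 := hlt _ (le_max_left a (b - η / 2)) hm
    have h4 := h2 (max a (b - η / 2)) (ha.trans (le_max_left _ _)) hm.le
      (lt_of_lt_of_le (by linarith) (le_max_right _ _))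
    exact (sd_triangle _ _ _).trans (add_le_add h3 h4.le)
  have hle' : ∀ u ∈ Icc a b, sd (P a) (P u) ≤ 1 := by
    intro u hu
    rcases hu.2.eq_or_lt with h | h
    · rwa [h]
    · exact hlt u hu.1 h
  have hge : 1 ≤ sd (P a) (P b) := by
    apply ENNReal.le_of_forall_pos_le_add
    intro ε hε _
    obtain ⟨η, hη, h1, -⟩ := hP b (ha.trans hab) ε (by exact_mod_cast hε)
    have hnot : b + η / 2 ∉ S := fun h => by linarith [le_csSup hbdd h]
    have hnot' : ¬ ∀ u ∈ Icc a (b + η / 2), sd (P a) (P u) ≤ 1 := fun h =>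
      hnot ⟨by linarith, h⟩
    push Not at hnot'
    obtain ⟨u, hu, hu1⟩ := hnot'
    have hbu : b ≤ u := by
      by_contra! hub
      exact absurd (hlt u hu.1 hub) (not_le.2 hu1)
    have h3 := h1 u (ha.trans hu.1) hbu (by linarith [hu.2])
    exact hu1.le.trans ((sd_triangle _ _ (P b)).trans (add_le_add_right h3.le _))
  have heq := le_antisymm hle hge
  refine ⟨b, lt_of_le_of_ne hab ?_, hle', heq⟩
  intro h
  rw [← h, sd_self] at heq
  exact zero_ne_one heq

/-- A quasi-geodesic ray can be subdivided into pieces whose end points have distance `1`; the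
subdivision exhausts the ray, as quasi-geodesics have finite length between points at finite
distance. -/
theorem exists_unit_subdivision {P : ℝ → X} (hP : IsDirectedOn P (Ici 0))
    (hleave : ∀ (x : X) (r : ℝ≥0), ∃ p, ∀ t, 0 ≤ t → p ≤ t → P t ∉ outBall x r)
    (hqg : IsQuasiGeodesicOn P (Ici 0)) {a : ℝ} (ha : 0 ≤ a) :
    ∃ t : ℕ → ℝ, t 0 = a ∧ (∀ i, t i < t (i + 1)) ∧
      (∀ i, ∀ u ∈ Icc (t i) (t (i + 1)), sd (P (t i)) (P u) ≤ 1) ∧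
      (∀ i, sd (P (t i)) (P (t (i + 1))) = 1) ∧ ∀ b, ∃ i, b < t i := by
  choose! next hn1 hn2 hn3 using fun a (ha : 0 ≤ a) => exists_unit_step hP hleave ha
  set t : ℕ → ℝ := fun n => next^[n] a with ht
  have ht0 : t 0 = a := rfl
  have hts : ∀ i, t (i + 1) = next (t i) := fun i => Function.iterate_succ_apply' _ _ _
  have hpos : ∀ i, a ≤ t i := by
    intro i
    induction i with
    | zero => exact le_rfl
    | succ i ih => rw [hts]; exact ih.trans (hn1 _ (ha.trans ih)).le
  have hpos0 : ∀ i, 0 ≤ t i := fun i => ha.trans (hpos i)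
  have hstep : ∀ i, t i < t (i + 1) := fun i => by rw [hts]; exact hn1 _ (hpos0 i)
  have hball : ∀ i, ∀ u ∈ Icc (t i) (t (i + 1)), sd (P (t i)) (P u) ≤ 1 := fun i => by
    rw [hts]; exact hn2 _ (hpos0 i)
  have hone : ∀ i, sd (P (t i)) (P (t (i + 1))) = 1 := fun i => by
    rw [hts]; exact hn3 _ (hpos0 i)
  refine ⟨t, ht0, hstep, hball, hone, ?_⟩
  by_contra! hbdd
  obtain ⟨b, hb⟩ := hbdd
  have hmono : StrictMono t := strictMono_nat_of_lt_succ hstep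
  have hB : BddAbove (range t) := ⟨b, by rintro _ ⟨i, rfl⟩; exact hb i⟩
  set T := ⨆ i, t i with hT
  have hlt : ∀ i, t i < T := fun i => (hstep i).trans_le (le_ciSup hB (i + 1))
  have haT : a < T := hlt 0
  -- the limit point of the subdivision is at finite distance from `P a`
  have hfin : sd (P a) (P T) ≠ ⊤ := by
    obtain ⟨η, hη, -, h2⟩ := isDirectedOn_iff.1 hP T (ha.trans haT.le) 1 one_pos
    obtain ⟨i, hi⟩ := exists_lt_of_lt_ciSup (show T - η < ⨆ i, t i by linarith)
    have h3 : sd (P a) (P (t i)) ≠ ⊤ := by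
      have := sd_le_sum_range (fun j => P (t j)) i
      refine ne_top_of_le_ne_top ?_ this
      simp [hone]
    refine ne_top_of_le_ne_top ?_ (sd_triangle _ _ (P (t i)))
    exact ENNReal.add_ne_top.2 ⟨h3, (h2 _ (hpos0 i) (hlt i).le hi).ne_top⟩
  obtain ⟨γ, c, -, hq⟩ := hqg
  have hlen : pathLength P a T ≠ ⊤ :=
    ne_top_of_le_ne_top (by finiteness) (hq a ha T (ha.trans haT.le) haT)
  have hsum : ∀ k : ℕ, (k : ℝ≥0∞) ≤ pathLength P a T := by
    intro k
    have := sum_sd_le_pathLength (P := P) (a := a) (b := T)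
      ⟨haT, hP.mono fun u hu => ha.trans hu.1⟩ (t := t) k
      (fun i _ => ⟨hpos i, (hlt i).le⟩) (fun i _ => (hstep i).le)
    simpa [hone] using this
  obtain ⟨k, hk⟩ := ENNReal.exists_nat_gt hlen
  exact absurd (hsum k) (not_le.2 hk)

/-- The sequence `e` consists of points of `U`, and every point of `U` is uniformly close from and
to points of the sequence. -/
def IsDiscretization (e : ℕ → X) (U : Set X) : Prop :=
  (∀ i, e i ∈ U) ∧ ∃ K, ∀ p ∈ U, (∃ i, Within (e i) p K) ∧ ∃ i, Within p (e i) K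

theorem IsDiscretization.op {e : ℕ → X} {U : Set X} (h : IsDiscretization e U) :
    IsDiscretization (X := Op X) e U :=
  ⟨h.1, h.2.choose, fun p hp => (h.2.choose_spec p hp).symm⟩

/-- Every quasi-geodesic ray has a discretization by a quasi-geodesic sequence: the points of a unit
subdivision.  The number of steps between two of its points is a lower bound for the length in
between. -/
theorem IsHypSpace.exists_discretization {δ : ℝ} {φ : ℝ → ℝ} (H : IsHypSpace X δ φ) {P : ℝ → X}
    (hP : IsDirectedOn P (Ici 0))
    (hleave : ∀ (x : X) (r : ℝ≥0), ∃ p, ∀ t, 0 ≤ t → p ≤ t → P t ∉ outBall x r)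
    (hqg : IsQuasiGeodesicOn P (Ici 0)) :
    ∃ e : ℕ → X, (∃ T γ c, IsQGSeq e T γ c) ∧ IsDiscretization e (P '' Ici 0) := by
  have cover : ∀ {t : ℕ → ℝ} {a b : ℝ}, t 0 = a → a ≤ b → (∃ i, b < t i) →
      ∃ i, t i ≤ b ∧ b < t (i + 1) := by
    intro t a b h0 hab hex
    classical
    have h1 := Nat.find_spec hex
    have h2 : Nat.find hex ≠ 0 := by
      intro h
      rw [h, h0] at h1
      linarith
    obtain ⟨i, hi⟩ := Nat.exists_eq_succ_of_ne_zero h2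
    refine ⟨i, not_lt.1 (Nat.find_min hex (by omega)), ?_⟩
    rwa [hi] at h1
  -- a subdivision starting at `a` shows that all later points are reached from `P a`
  have hreach : ∀ a b, 0 ≤ a → a ≤ b → Reach (P a) (P b) := by
    intro a b ha hab
    obtain ⟨t, ht0, hstep, hball, -, hex⟩ := exists_unit_subdivision hP hleave hqg ha
    obtain ⟨i, hi, hi'⟩ := cover ht0 hab (hex b)
    have h1 : ∀ j, Reach (P a) (P (t j)) := by
      intro j
      induction j with
      | zero => rw [ht0]; exact Reach.refl _
      | succ j ih =>
        refine ih.trans (ne_top_of_le_ne_top ENNReal.one_ne_top (hball j _ ⟨(hstep j).le, le_rfl⟩))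
    exact (h1 i).trans (ne_top_of_le_ne_top ENNReal.one_ne_top (hball i b ⟨hi, hi'.le⟩))
  obtain ⟨t, ht0, hstep, hball, hone, hex⟩ := exists_unit_subdivision hP hleave hqg le_rfl
  have hmono : StrictMono t := strictMono_nat_of_lt_succ hstep
  have hpos : ∀ i, 0 ≤ t i := fun i => ht0.symm.le.trans (hmono.monotone (Nat.zero_le i))
  have hball' : ∀ i, ∀ u ∈ Icc (t i) (t (i + 1)), Within (P (t i)) (P u) 1 := fun i u hu =>
    (within_iff zero_le_one).2 (by simpa using hball i u hu)
  obtain ⟨γ, c, -, hq⟩ := hqg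
  refine ⟨fun i => P (t i), ⟨1, γ, c, zero_le_one, γ.2,
    fun i => hball' i _ ⟨(hstep i).le, le_rfl⟩, ?_⟩, fun i => ⟨_, hpos i, rfl⟩, 1 + |φ 1|, ?_⟩
  · intro i j hij
    rcases hij.eq_or_lt with rfl | hij
    · simp
    have hr : Reach (P (t i)) (P (t j)) := hreach _ _ (hpos i) (hmono hij).le
    have h1 := sum_sd_le_pathLength (P := P) (a := t i) (b := t j)
      ⟨hmono hij, hP.mono fun u hu => (hpos i).trans hu.1⟩ (t := fun k => t (i + k)) (j - i)
      (fun k hk => ⟨hmono.monotone (by omega), hmono.monotone (by omega)⟩)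
      (fun k _ => (hstep (i + k)).le)
    have h2 := h1.trans (hq _ (hpos i) _ (hpos j) (hmono hij))
    have h3 : ∀ k, sd (P (t (i + k))) (P (t (i + (k + 1)))) = 1 := fun k => hone (i + k)
    simp only [h3, Finset.sum_const, Finset.card_range, nsmul_eq_mul, mul_one] at h2
    have h4 := ENNReal.toReal_mono (ENNReal.add_ne_top.2
      ⟨ENNReal.mul_ne_top ENNReal.coe_ne_top hr, ENNReal.coe_ne_top⟩) h2
    rw [ENNReal.toReal_add (ENNReal.mul_ne_top ENNReal.coe_ne_top hr) ENNReal.coe_ne_top,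
      ENNReal.toReal_mul, ENNReal.toReal_natCast, Nat.cast_sub hij.le] at h4
    exact h4
  · rintro _ ⟨b, hb, rfl⟩
    obtain ⟨i, hi, hi'⟩ := cover ht0 hb (hex b)
    have h1 := hball' i b ⟨hi, hi'.le⟩
    have h0 := abs_nonneg (φ 1)
    refine ⟨⟨i, h1.mono (by linarith)⟩, i + 1, hreach _ _ hb hi'.le, ?_⟩
    -- both points lie in the unit out-ball around `P (t i)`
    have := H.out_bound h1 (hball' i _ ⟨(hstep i).le, le_rfl⟩) (hreach _ _ hb hi'.le)
    linarith [le_abs_self (φ 1)]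

/-! ### Realization of quasi-geodesic sequences -/

/-- Joining consecutive points of a quasi-geodesic sequence by geodesics yields a Lipschitz map on
`[0, ∞)` whose parametrization is quasi-isometric. -/
theorem IsHypSpace.exists_realization {δ : ℝ} {φ : ℝ → ℝ} (H : IsHypSpace X δ φ) {e : ℕ → X}
    {T γ c : ℝ} (he : IsQGSeq e T γ c) :
    ∃ Q : ℝ → X, (∀ s t, 0 ≤ s → s ≤ t → Within (Q s) (Q t) (T * (t - s))) ∧
      (∃ c', ∀ s t, 0 ≤ s → s ≤ t → t - s ≤ γ * rdist (Q s) (Q t) + c') ∧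
      (∀ i : ℕ, Q i = e i) := by
  have hT := he.step_nonneg
  have hγ := he.factor_nonneg
  choose g hg using fun i => H.exists_geo (e i) (e (i + 1)) (he.step i).1
  set d : ℕ → ℝ := fun i => rdist (e i) (e (i + 1)) with hd
  have hd0 : ∀ i, 0 ≤ d i := fun i => rdist_nonneg _ _
  have hdT : ∀ i, d i ≤ T := fun i => (he.step i).2
  set Q : ℝ → X := fun t => g ⌊t⌋₊ ((t - ⌊t⌋₊) * d ⌊t⌋₊) with hQ
  have param : ∀ t, 0 ≤ t → 0 ≤ (t - ⌊t⌋₊) * d ⌊t⌋₊ ∧ (t - ⌊t⌋₊) * d ⌊t⌋₊ ≤ d ⌊t⌋₊ := by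
    intro t ht
    have h1 := Nat.floor_le ht
    have h2 := Nat.lt_floor_add_one t
    have h3 := hd0 ⌊t⌋₊
    exact ⟨mul_nonneg (by linarith) h3, mul_le_of_le_one_left h3 (by linarith)⟩
  have left : ∀ t, 0 ≤ t → Within (e ⌊t⌋₊) (Q t) (T * (t - ⌊t⌋₊)) := by
    intro t ht
    refine ((hg _).within_left (param t ht).1 (param t ht).2).mono ?_
    rw [mul_comm]
    exact mul_le_mul_of_nonneg_right (hdT _) (by linarith [Nat.floor_le ht])
  have right : ∀ t, 0 ≤ t → Within (Q t) (e (⌊t⌋₊ + 1)) (T * (⌊t⌋₊ + 1 - t)) := by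
    intro t ht
    refine ((hg _).within_right (param t ht).1 (param t ht).2).mono ?_
    have h2 := Nat.lt_floor_add_one t
    calc d ⌊t⌋₊ - (t - ⌊t⌋₊) * d ⌊t⌋₊ = d ⌊t⌋₊ * (⌊t⌋₊ + 1 - t) := by ring
      _ ≤ _ := mul_le_mul_of_nonneg_right (hdT _) (by linarith)
  refine ⟨Q, ?_, ⟨γ * (2 * T) + c + 1, ?_⟩, ?_⟩
  · intro s t hs hst
    have ht := hs.trans hst
    rcases (Nat.floor_le_floor hst).eq_or_lt with h | h
    · have h1 := param s hs
      have h2 := param t ht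
      simp only [hQ]
      rw [← h] at h2 ⊢
      refine ((hg _).within h1.1 ?_ h2.2).mono ?_
      · have := hd0 ⌊s⌋₊
        gcongr
      · rw [← sub_mul, sub_sub_sub_cancel_right, mul_comm]
        exact mul_le_mul_of_nonneg_right (hdT _) (by linarith)
    · have h1 := ((right s hs).trans (he.within h)).trans (left t ht)
      refine h1.mono (le_of_eq ?_)
      push_cast
      ring
  · intro s t hs hst
    have ht := hs.trans hst
    have h1 := he.quasi ⌊s⌋₊ (⌊t⌋₊ + 1) ((Nat.floor_le_floor hst).trans (Nat.le_succ _))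
    have hls := Nat.floor_le hs
    have hls' := Nat.lt_floor_add_one s
    have hlt := Nat.floor_le ht
    have hlt' := Nat.lt_floor_add_one t
    have hst' : Reach (Q s) (Q t) := by
      rcases (Nat.floor_le_floor hst).eq_or_lt with h | h
      · have h1 := param s hs
        have h2 := param t ht
        simp only [hQ]
        rw [← h] at h2 ⊢
        refine ((hg _).within h1.1 ?_ h2.2).1
        have := hd0 ⌊s⌋₊
        gcongr
      · exact (((right s hs).trans (he.within h)).trans (left t ht)).1
    have h2 := (((left s hs).trans hst'.within).trans (right t ht)).2
    have h3 : rdist (e ⌊s⌋₊) (e (⌊t⌋₊ + 1)) ≤ 2 * T + rdist (Q s) (Q t) := by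
      nlinarith
    have h4 := mul_le_mul_of_nonneg_left h3 hγ
    push_cast at h1
    linarith
  · intro i
    simp only [hQ, Nat.floor_natCast, sub_self, zero_mul]
    exact (hg i).left

/-! ### Rays and anti-rays as quasi-geodesic sequences -/

/-- The sequence discretizes the (anti-)ray `R` and runs in the same direction: it is quasi-geodesic
in the space for a ray and in the opposite space for an anti-ray. -/
def Discretizes (e : ℕ → X) (R : QGRay X ⊕ QGAntiRay X) : Prop :=
  IsDiscretization e (image R) ∧
    R.elim (fun _ => ∃ T γ c, IsQGSeq e T γ c) (fun _ => ∃ T γ c, IsQGSeq (X := Op X) e T γ c)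

theorem Discretizes.isEndSeq {e : ℕ → X} {R : QGRay X ⊕ QGAntiRay X} (h : Discretizes e R) :
    IsEndSeq e := by
  rcases R with R | R
  · exact Or.inl h.2
  · exact Or.inr h.2

theorem neg_mem_Ici_zero {t : ℝ} (ht : t ∈ Iic (0 : ℝ)) : -t ∈ Ici (0 : ℝ) := by
  simpa using ht

theorem neg_mem_Iic_zero {t : ℝ} (ht : t ∈ Ici (0 : ℝ)) : -t ∈ Iic (0 : ℝ) := by
  simpa using ht

theorem pathLength_op (P : ℝ → X) (a b : ℝ) :
    pathLength (X := Op X) (fun t => P (-t)) a b = pathLength P (-b) (-a) := by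
  refine (pathLength_eq (X := Op X) (fun t => P (-t)) a b).trans
    (Eq.trans ?_ (pathLength_eq P (-b) (-a)).symm)
  refine limsup_congr ?_
  filter_upwards [eventually_gt_atTop 0] with N hN
  have hnode : ∀ i ≤ N, -node a b N i = node (-b) (-a) N (N - i) := by
    intro i hi
    have : (N : ℝ) ≠ 0 := by positivity
    unfold node
    rw [Nat.cast_sub hi]
    field_simp
    ring
  rw [← Finset.sum_range_reflect]
  refine Finset.sum_congr rfl fun i hi => ?_
  have hi : i < N := Finset.mem_range.1 hi
  change sd (X := X) (P (-node a b N (N - 1 - i + 1))) (P (-node a b N (N - 1 - i))) = _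
  rw [hnode _ (by omega), hnode _ (by omega)]
  congr 3 <;> omega

theorem IsDirectedOn.reverse {P : ℝ → X} {I J : Set ℝ} (h : IsDirectedOn P I)
    (hJ : ∀ t ∈ J, -t ∈ I) : IsDirectedOn (X := Op X) (fun t => P (-t)) J := by
  refine isDirectedOn_iff.2 fun t ht ε hε => ?_
  obtain ⟨η, hη, h1, h2⟩ := isDirectedOn_iff.1 h (-t) (hJ t ht) ε hε
  refine ⟨η, hη, fun s hs hts hst => ?_, fun s hs hts hst => ?_⟩
  · exact h2 (-s) (hJ s hs) (by linarith) (by linarith)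
  · exact h1 (-s) (hJ s hs) (by linarith) (by linarith)

theorem IsQuasiGeodesicOn.reverse {P : ℝ → X} {I J : Set ℝ} (h : IsQuasiGeodesicOn P I)
    (hJ : ∀ t ∈ J, -t ∈ I) : IsQuasiGeodesicOn (X := Op X) (fun t => P (-t)) J := by
  obtain ⟨γ, c, hγ, hq⟩ := h
  refine ⟨γ, c, hγ, fun s hs t ht hst => ?_⟩
  exact (pathLength_op P s t).le.trans (hq (-t) (hJ t ht) (-s) (hJ s hs) (by linarith))

namespace IsHypSpace

variable {δ : ℝ} {φ : ℝ → ℝ}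

theorem exists_discretizes_ray (H : IsHypSpace X δ φ) (R : QGRay X) :
    ∃ e, Discretizes e (Sum.inl R) := by
  have hext : ∀ t (ht : (0 : ℝ) ≤ t), IciExtend R.toFun t = R.toFun ⟨t, ht⟩ := fun t ht =>
    IciExtend_of_mem R.toFun ht
  obtain ⟨e, he, hd⟩ := H.exists_discretization R.directed (fun x r => by
    obtain ⟨p, hp⟩ := R.leaves x r
    refine ⟨p, fun t ht hpt => ?_⟩
    rw [hext t ht]
    exact hp _ hpt) R.quasiGeodesic
  refine ⟨e, ?_, he⟩
  convert hd using 1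
  ext x
  constructor
  · rintro ⟨t, rfl⟩
    exact ⟨t, t.2, hext t t.2⟩
  · rintro ⟨t, ht, rfl⟩
    exact ⟨⟨t, ht⟩, (hext t ht).symm⟩

theorem exists_discretizes_antiRay (H : IsHypSpace X δ φ) (R : QGAntiRay X) :
    ∃ e, Discretizes e (Sum.inr R) := by
  have hext : ∀ t (ht : t ≤ (0 : ℝ)), IicExtend R.toFun t = R.toFun ⟨t, ht⟩ := fun t ht =>
    IicExtend_of_mem R.toFun ht
  obtain ⟨e, he, hd⟩ := H.op.exists_discretization
    (R.directed.reverse (J := Ici 0) fun _ => neg_mem_Iic_zero) (fun x r => by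
    obtain ⟨p, hp⟩ := R.leaves x r
    refine ⟨-p, fun t ht hpt => ?_⟩
    have ht' : -t ≤ 0 := by linarith
    have := hp ⟨-t, ht'⟩ (show -t ≤ (p : ℝ) by linarith)
    rw [← hext (-t) ht'] at this
    exact this) (R.quasiGeodesic.reverse (J := Ici 0) fun _ => neg_mem_Iic_zero)
  have hU : image (Sum.inr R) = (fun t => IicExtend R.toFun (-t)) '' Ici (0 : ℝ) := by
    apply Subset.antisymm
    · rintro _ ⟨t, rfl⟩
      refine ⟨-t, neg_mem_Ici_zero t.2, ?_⟩
      simp only [neg_neg]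
      exact hext t t.2
    · rintro _ ⟨t, ht, rfl⟩
      have ht' : -t ≤ 0 := by simpa using ht
      exact ⟨⟨-t, ht'⟩, (hext (-t) ht').symm⟩
  exact ⟨e, hU ▸ IsDiscretization.op (X := Op X) hd, he⟩

theorem exists_discretizes (H : IsHypSpace X δ φ) (R : QGRay X ⊕ QGAntiRay X) :
    ∃ e, Discretizes e R := by
  rcases R with R | R
  · exact H.exists_discretizes_ray R
  · exact H.exists_discretizes_antiRay R

end IsHypSpace

/-- A Lipschitz map whose parametrization is quasi-isometric is quasi-geodesic. -/
theorem isQuasiGeodesicOn_of_lipschitz {P : ℝ → X} {I : Set ℝ} (hI : I.OrdConnected) {K γ c : ℝ}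
    (hK : 0 ≤ K) (h : ∀ s ∈ I, ∀ t ∈ I, s ≤ t → Within (P s) (P t) (K * (t - s)))
    (h' : ∀ s ∈ I, ∀ t ∈ I, s ≤ t → t - s ≤ γ * rdist (P s) (P t) + c) :
    IsQuasiGeodesicOn P I := by
  refine ⟨max 1 (K * γ).toNNReal, (K * c).toNNReal, le_max_left _ _, fun s hs t ht hst => ?_⟩
  have hsub : Icc s t ⊆ I := hI.out hs ht
  refine (pathLength_le_of_lipschitz hst.le
    fun u hu v hv huv => h u (hsub hu) v (hsub hv) huv).trans ?_
  have h1 := h' s hs t ht hst.le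
  have hr := (h s hs t ht hst.le).1
  have h0 := rdist_nonneg (P s) (P t)
  rw [← ENNReal.ofReal_toReal hr, ← rdist, ← ENNReal.ofReal_coe_nnreal, ← ENNReal.ofReal_coe_nnreal,
    ← ENNReal.ofReal_mul (NNReal.coe_nonneg _), ← ENNReal.ofReal_add
      (mul_nonneg (NNReal.coe_nonneg _) h0) (NNReal.coe_nonneg _)]
  apply ENNReal.ofReal_le_ofReal
  have h2 : K * γ ≤ ((max 1 (K * γ).toNNReal : ℝ≥0) : ℝ) :=
    (Real.le_coe_toNNReal _).trans (NNReal.coe_le_coe.2 (le_max_right _ _))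
  have h3 := Real.le_coe_toNNReal (K * c)
  have h4 := mul_le_mul_of_nonneg_left h1 hK
  have h5 := mul_le_mul_of_nonneg_right h2 h0
  linarith

namespace IsHypSpace

variable {δ : ℝ} {φ : ℝ → ℝ}

theorem exists_ray_of_isQGSeq (H : IsHypSpace X δ φ) {e : ℕ → X} {T γ c : ℝ}
    (he : IsQGSeq e T γ c) : ∃ R : QGRay X, Discretizes e (Sum.inl R) := by
  obtain ⟨Q, hlip, ⟨c', hc'⟩, hQe⟩ := H.exists_realization he
  have hT := he.step_nonneg
  set F : Ici (0 : ℝ) → X := fun t => Q t with hF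
  have hext : ∀ t, 0 ≤ t → IciExtend F t = Q t := fun t ht => IciExtend_of_mem F ht
  have hl : ∀ s ∈ Ici (0 : ℝ), ∀ t ∈ Ici (0 : ℝ), s ≤ t →
      Within (IciExtend F s) (IciExtend F t) (T * (t - s)) := by
    intro s hs t ht hst
    rw [hext s hs, hext t ht]
    exact hlip s t hs hst
  -- the next point of the sequence is close from each point of the ray
  have hnext : ∀ t, 0 ≤ t → Within (Q t) (e (⌊t⌋₊ + 1)) T := by
    intro t ht
    have h1 := Nat.floor_le ht
    have h2 := Nat.lt_floor_add_one t
    rw [← hQe]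
    refine (hlip _ _ ht (by push_cast; exact h2.le)).mono ?_
    push_cast
    nlinarith
  have hprev : ∀ t, 0 ≤ t → Within (e ⌊t⌋₊) (Q t) T := by
    intro t ht
    have h1 := Nat.floor_le ht
    have h2 := Nat.lt_floor_add_one t
    rw [← hQe]
    refine (hlip _ _ (by positivity) h1).mono ?_
    nlinarith
  refine ⟨⟨F, isDirectedOn_of_lipschitz hl, ?_, isQuasiGeodesicOn_of_lipschitz
    (γ := γ) (c := c') ordConnected_Ici hT hl ?_⟩, ⟨?_, T, ?_⟩, T, γ, c, he⟩
  · intro x r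
    obtain ⟨N, hN⟩ := (H.isProperSeq_of_isQGSeq he).leaves_out x (r + T)
    refine ⟨⟨N, by simp⟩, fun t hNt hx => ?_⟩
    have hNt : (N : ℝ) ≤ t := hNt
    have := Nat.le_floor hNt
    exact hN _ (by omega) ((within_iff_nnreal.2 hx).trans (hnext t t.2))
  · intro s hs t ht hst
    rw [hext s hs, hext t ht]
    exact hc' s t hs hst
  · exact fun i => ⟨⟨i, by simp⟩, hQe i⟩
  · rintro _ ⟨t, rfl⟩
    exact ⟨⟨_, hprev t t.2⟩, _, hnext t t.2⟩

theorem exists_antiRay_of_isQGSeq (H : IsHypSpace X δ φ) {e : ℕ → X} {T γ c : ℝ}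
    (he : IsQGSeq (X := Op X) e T γ c) : ∃ R : QGAntiRay X, Discretizes e (Sum.inr R) := by
  obtain ⟨R, ⟨hd, -⟩⟩ := H.op.exists_ray_of_isQGSeq he
  have hext : ∀ t (ht : (0 : ℝ) ≤ t), IciExtend R.toFun t = R.toFun ⟨t, ht⟩ := fun t ht =>
    IciExtend_of_mem R.toFun ht
  set F : Iic (0 : ℝ) → X := fun t => R.toFun ⟨-t, neg_mem_Ici_zero t.2⟩ with hF
  have hFext : IicExtend F = fun t => IciExtend R.toFun (-t) := by
    funext t
    refine congrArg R.toFun (Subtype.ext ?_)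
    change -min 0 t = max 0 (-t)
    rw [← max_neg_neg, neg_zero]
  have hU : range F = range R.toFun := by
    apply Subset.antisymm
    · rintro _ ⟨t, rfl⟩
      exact ⟨_, rfl⟩
    · rintro _ ⟨t, rfl⟩
      exact ⟨⟨-t, neg_mem_Iic_zero t.2⟩, congrArg R.toFun (Subtype.ext (neg_neg _))⟩
  refine ⟨⟨F, ?_, ?_, ?_⟩, (hU ▸ IsDiscretization.op (X := Op X) hd : IsDiscretization e (range F)),
    T, γ, c, he⟩
  · rw [hFext]
    exact IsDirectedOn.reverse (X := Op X) R.directed fun _ => neg_mem_Ici_zero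
  · intro x r
    obtain ⟨p, hp⟩ := R.leaves x r
    refine ⟨⟨-p, neg_mem_Iic_zero p.2⟩, fun t ht => hp _ ?_⟩
    have ht : (t : ℝ) ≤ -p := ht
    exact show (p : ℝ) ≤ -t by linarith
  · rw [hFext]
    exact IsQuasiGeodesicOn.reverse (X := Op X) R.quasiGeodesic fun _ => neg_mem_Ici_zero

end IsHypSpace

/-! ### The order on the boundary in terms of sequences -/

theorem IsHypSpace.seqLE_of_setLE {δ : ℝ} {φ : ℝ → ℝ} (H : IsHypSpace X δ φ) {u v : ℕ → X}
    {U V : Set X} (hu : IsEndSeq u) (hv : IsEndSeq v) (hU : IsDiscretization u U)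
    (hV : IsDiscretization v V) (h : SetLE U V) : SeqLE u v := by
  obtain ⟨M, hM⟩ := h
  obtain ⟨-, K, hK⟩ := hU
  obtain ⟨-, K', hK'⟩ := hV
  have pu := H.isProperSeq hu
  have pv := H.isProperSeq hv
  refine ⟨K + M + K', fun N => ?_⟩
  obtain ⟨b', C', hb'⟩ := pv.within_to N
  obtain ⟨N₁, hN₁⟩ := pu.leaves_in b' (K + M + K' + C')
  obtain ⟨b, C, hb⟩ := pu.within_from (N + N₁)
  -- a path outside a large out-ball around `b` starts close to a late point of `u`
  obtain ⟨P, s, t, hP, hPs, hPt, hlen, hdisj⟩ := hM (C + K).toNNReal b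
  obtain ⟨⟨i, hi⟩, -⟩ := hK _ hPs
  obtain ⟨-, j, hj⟩ := hK' _ hPt
  have hst : Within (P s) (P t) M := within_iff_nnreal.2 ((sd_le_pathLength P s t).trans hlen)
  have hW := (hi.trans hst).trans hj
  have hNi : N + N₁ ≤ i := by
    by_contra! hlt
    refine disjoint_left.1 hdisj ⟨s, ⟨le_rfl, hP.1.le⟩, rfl⟩ (Or.inl ?_)
    exact within_iff_nnreal.1 (((hb i hlt).trans hi).mono (Real.le_coe_toNNReal _))
  refine ⟨i, by omega, j, ?_, hW⟩
  -- late points of `u` are not close to early points of `v`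
  by_contra! hlt
  exact hN₁ i (by omega) (hW.trans (hb' j hlt))

theorem IsHypSpace.setLE_of_seqLE {δ : ℝ} {φ : ℝ → ℝ} (H : IsHypSpace X δ φ) {u v : ℕ → X}
    {U V : Set X} (hu : IsEndSeq u) (hv : IsEndSeq v) (hU : IsDiscretization u U)
    (hV : IsDiscretization v V) (h : SeqLE u v) : SetLE U V := by
  obtain ⟨M, hM⟩ := h
  refine ⟨M.toNNReal, fun r x => ?_⟩
  obtain ⟨N₁, hN₁⟩ := (H.isProperSeq hu).leaves_in x (M + r)
  obtain ⟨N₂, hN₂⟩ := (H.isProperSeq hv).leaves_out x (r + M)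
  obtain ⟨i, hi, j, hj, hW⟩ := hM (N₁ + N₂)
  obtain ⟨g, hg⟩ := H.exists_geo _ _ hW.1
  have hgeod := hg.isGeodesic
  refine ⟨_, 0, 1, hgeod.1, ?_, ?_, ?_, ?_⟩
  · simpa [hg.left] using hU.1 i
  · simpa [hg.right] using hV.1 j
  · rw [hgeod.2.2.2]
    exact (within_iff hW.nonneg).1 hW
  · rw [disjoint_left]
    rintro _ ⟨s, hs, rfl⟩ hball
    have hℓ := hg.length_nonneg
    have h0 : 0 ≤ s * rdist (u i) (v j) := mul_nonneg hs.1 hℓ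
    have h1 : s * rdist (u i) (v j) ≤ rdist (u i) (v j) := mul_le_of_le_one_left hℓ hs.2
    rcases hball with hball | hball
    · refine hN₂ j (by omega) (((within_iff_nnreal (r := r)).2 hball).trans
        ((hg.within_right h0 h1).mono ?_))
      linarith [hW.2]
    · refine hN₁ i (by omega) (((hg.within_left h0 h1).mono ?_).trans
        ((within_iff_nnreal (r := r)).2 hball))
      linarith [hW.2]

theorem IsHypSpace.bothLE_iff {δ : ℝ} {φ : ℝ → ℝ} (H : IsHypSpace X δ φ)
    {R Q : QGRay X ⊕ QGAntiRay X} {u v : ℕ → X} (hu : Discretizes u R) (hv : Discretizes v Q) :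
    bothLE R Q ↔ SeqLE u v :=
  ⟨H.seqLE_of_setLE hu.isEndSeq hv.isEndSeq hu.1 hv.1,
    H.setLE_of_seqLE hu.isEndSeq hv.isEndSeq hu.1 hv.1⟩

theorem IsHypSpace.bothLE_refl {δ : ℝ} {φ : ℝ → ℝ} (H : IsHypSpace X δ φ)
    (R : QGRay X ⊕ QGAntiRay X) : bothLE R R := by
  obtain ⟨u, hu⟩ := H.exists_discretizes R
  exact (H.bothLE_iff hu hu).2 ⟨0, fun N => ⟨N, le_rfl, N, le_rfl, Within.refl _ le_rfl⟩⟩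

theorem IsHypSpace.bothLE_trans {δ : ℝ} {φ : ℝ → ℝ} (H : IsHypSpace X δ φ)
    {R Q S : QGRay X ⊕ QGAntiRay X} (hRQ : bothLE R Q) (hQS : bothLE Q S) : bothLE R S := by
  obtain ⟨u, hu⟩ := H.exists_discretizes R
  obtain ⟨v, hv⟩ := H.exists_discretizes Q
  obtain ⟨w, hw⟩ := H.exists_discretizes S
  obtain ⟨A, hA, HA⟩ := H.exists_linear
  rw [H.bothLE_iff hu hv] at hRQ
  rw [H.bothLE_iff hv hw] at hQS
  rw [H.bothLE_iff hu hw]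
  exact HA.seqLE_trans hA hu.isEndSeq hv.isEndSeq hw.isEndSeq hRQ hQS

/-! ### Quasi-isometries -/

variable {Y : Type*} [SemimetricSpace Y]

/-- The defining properties of a quasi-isometry, expressed by real distances. -/
structure IsQI (f : X → Y) (γ c : ℝ) : Prop where
  factor_nonneg : 0 ≤ γ
  const_nonneg : 0 ≤ c
  map : ∀ {x x' : X} {r : ℝ}, Within x x' r → Within (f x) (f x') (γ * r + c)
  comap : ∀ {x x' : X} {r : ℝ}, Within (f x) (f x') r → Within x x' (γ * r + c)
  dense : ∀ y : Y, ∃ x : X, Within (f x) y c ∧ Within y (f x) c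

theorem IsQI.op {f : X → Y} {γ c : ℝ} (h : IsQI f γ c) : IsQI (X := Op X) (Y := Op Y) f γ c where
  factor_nonneg := h.factor_nonneg
  const_nonneg := h.const_nonneg
  map hW := h.map (X := X) hW
  comap hW := h.comap (X := X) hW
  dense y := by
    obtain ⟨x, h1, h2⟩ := h.dense y
    exact ⟨x, h2, h1⟩

theorem IsQuasiIsometry.exists_isQI {f : X → Y} (hf : IsQuasiIsometry f) : ∃ γ c, IsQI f γ c := by
  obtain ⟨γ, c, hγ, hd, hs⟩ := hf
  have hγ0 : 0 < γ := lt_of_lt_of_le one_pos hγ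
  have hγ1 : (1 : ℝ) ≤ γ := hγ
  refine ⟨γ, γ * c, γ.2, by positivity, ?_, ?_, ?_⟩
  · intro x x' r h
    have hr := h.nonneg
    refine ((within_iff (by positivity : (0 : ℝ) ≤ γ * r + c)).2
      ((hd x x').2.trans ?_)).mono ?_
    · rw [ENNReal.ofReal_add (by positivity) (by positivity), ENNReal.ofReal_mul (by positivity),
        ENNReal.ofReal_coe_nnreal, ENNReal.ofReal_coe_nnreal]
      gcongr
      exact (within_iff hr).1 h
    · have : (0 : ℝ) ≤ c := c.2
      nlinarith
  · intro x x' r h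
    have hr := h.nonneg
    refine (within_iff (by positivity)).2 ?_
    have h1 : ((γ⁻¹ : ℝ≥0) : ℝ≥0∞) * sd x x' ≤ ENNReal.ofReal r + c :=
      (tsub_le_iff_right.1 (hd x x').1).trans (by gcongr; exact (within_iff hr).1 h)
    calc sd x x' = γ * (((γ⁻¹ : ℝ≥0) : ℝ≥0∞) * sd x x') := by
          rw [← mul_assoc, ← ENNReal.coe_mul, mul_inv_cancel₀ hγ0.ne', ENNReal.coe_one, one_mul]
      _ ≤ γ * (ENNReal.ofReal r + c) := by gcongr
      _ = ENNReal.ofReal (γ * r + γ * c) := by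
        rw [← mul_add, ENNReal.ofReal_mul (by positivity), ENNReal.ofReal_add hr (by positivity),
          ENNReal.ofReal_coe_nnreal, ENNReal.ofReal_coe_nnreal]
  · intro y
    obtain ⟨x, h1, h2⟩ := hs y
    have hc : (c : ℝ) ≤ γ * c := le_mul_of_one_le_left c.2 hγ1
    exact ⟨x, (within_iff_nnreal.2 h1).mono hc, (within_iff_nnreal.2 h2).mono hc⟩

/-- A quasi-isometry has a quasi-inverse. -/
theorem IsQI.exists_inverse {f : X → Y} {γ c : ℝ} (h : IsQI f γ c) :
    ∃ g : Y → X, (∃ γ' c', IsQI g γ' c') ∧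
      ∀ y, Within (f (g y)) y c ∧ Within y (f (g y)) c := by
  choose g hg1 hg2 using h.dense
  have hγ := h.factor_nonneg
  have hc := h.const_nonneg
  refine ⟨g, ⟨γ, γ * (2 * c) + c + 2 * c, hγ, by positivity, ?_, ?_, ?_⟩,
    fun y => ⟨hg1 y, hg2 y⟩⟩
  · intro y y' r hW
    refine (h.comap (((hg1 y).trans hW).trans (hg2 y'))).mono ?_
    linarith
  · intro y y' r hW
    refine (((hg2 y).trans (h.map hW)).trans (hg1 y')).mono ?_
    have := mul_nonneg hγ hc
    linarith
  · intro x
    have := mul_nonneg hγ hc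
    exact ⟨f x, (h.comap (hg1 (f x))).mono (by linarith), (h.comap (hg2 (f x))).mono (by linarith)⟩

theorem IsQI.isQGSeq {f : X → Y} {γ c : ℝ} (h : IsQI f γ c) {e : ℕ → X} {T γ' c' : ℝ}
    (he : IsQGSeq e T γ' c') :
    IsQGSeq (fun i => f (e i)) (γ * T + c) (γ' * γ) (γ' * c + c') where
  step_nonneg := by
    have := h.factor_nonneg
    have := h.const_nonneg
    have := he.step_nonneg
    positivity
  factor_nonneg := mul_nonneg he.factor_nonneg h.factor_nonneg
  step i := h.map (he.step i)
  quasi i j hij := by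
    have h1 := (h.comap (h.map (he.within hij)).1.within).2
    have h2 := mul_le_mul_of_nonneg_left h1 he.factor_nonneg
    have h3 := he.quasi i j hij
    linarith

theorem IsQI.isEndSeq {f : X → Y} {γ c : ℝ} (h : IsQI f γ c) {e : ℕ → X} (he : IsEndSeq e) :
    IsEndSeq (fun i => f (e i)) := by
  rcases he with ⟨T, γ', c', he⟩ | ⟨T, γ', c', he⟩
  · exact Or.inl ⟨_, _, _, h.isQGSeq he⟩
  · exact Or.inr ⟨_, _, _, h.op.isQGSeq he⟩

theorem IsQI.seqLE_iff {f : X → Y} {γ c : ℝ} (h : IsQI f γ c) {u v : ℕ → X} :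
    SeqLE (fun i => f (u i)) (fun i => f (v i)) ↔ SeqLE u v := by
  constructor
  · rintro ⟨M, hM⟩
    refine ⟨γ * M + c, fun N => ?_⟩
    obtain ⟨i, hi, j, hj, hW⟩ := hM N
    exact ⟨i, hi, j, hj, h.comap hW⟩
  · rintro ⟨M, hM⟩
    refine ⟨γ * M + c, fun N => ?_⟩
    obtain ⟨i, hi, j, hj, hW⟩ := hM N
    exact ⟨i, hi, j, hj, h.map hW⟩

theorem closeSets_iff {U V : Set X} : CloseSets U V ↔ ∃ K : ℝ,
    (∀ p ∈ U, (∃ q ∈ V, Within q p K) ∧ ∃ q ∈ V, Within p q K) ∧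
    ∀ q ∈ V, (∃ p ∈ U, Within p q K) ∧ ∃ p ∈ U, Within q p K := by
  constructor
  · rintro ⟨K, h1, h2⟩
    refine ⟨K, fun p hp => ⟨?_, ?_⟩, fun q hq => ⟨?_, ?_⟩⟩
    · obtain ⟨q, hq, h⟩ := (h1 hp).1; exact ⟨q, hq, within_iff_nnreal.2 h⟩
    · obtain ⟨q, hq, h⟩ := (h1 hp).2; exact ⟨q, hq, within_iff_nnreal.2 h⟩
    · obtain ⟨p, hp, h⟩ := (h2 hq).1; exact ⟨p, hp, within_iff_nnreal.2 h⟩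
    · obtain ⟨p, hp, h⟩ := (h2 hq).2; exact ⟨p, hp, within_iff_nnreal.2 h⟩
  · rintro ⟨K, h1, h2⟩
    have hK : ∀ {x y : X}, Within x y K → sd x y ≤ K.toNNReal := fun h =>
      within_iff_nnreal.1 (h.mono (Real.le_coe_toNNReal K))
    refine ⟨K.toNNReal, fun p hp => ⟨?_, ?_⟩, fun q hq => ⟨?_, ?_⟩⟩
    · obtain ⟨q, hq, h⟩ := (h1 p hp).1; exact ⟨q, hq, hK h⟩
    · obtain ⟨q, hq, h⟩ := (h1 p hp).2; exact ⟨q, hq, hK h⟩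
    · obtain ⟨p, hp, h⟩ := (h2 q hq).1; exact ⟨p, hp, hK h⟩
    · obtain ⟨p, hp, h⟩ := (h2 q hq).2; exact ⟨p, hp, hK h⟩

/-- If `u` discretizes `U` and its image under a quasi-isometry `f` discretizes `V`, then `f '' U`
and `V` are close to each other. -/
theorem IsQI.closeSets {f : X → Y} {γ c : ℝ} (h : IsQI f γ c) {u : ℕ → X} {U : Set X} {V : Set Y}
    (hU : IsDiscretization u U) (hV : IsDiscretization (fun i => f (u i)) V) :
    CloseSets (f '' U) V := by
  obtain ⟨hu, K, hK⟩ := hU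
  obtain ⟨hv, K', hK'⟩ := hV
  rw [closeSets_iff]
  refine ⟨max (γ * K + c) K', ?_, ?_⟩
  · rintro _ ⟨x, hx, rfl⟩
    obtain ⟨⟨i, hi⟩, j, hj⟩ := hK x hx
    exact ⟨⟨_, hv i, (h.map hi).mono (le_max_left _ _)⟩, _, hv j, (h.map hj).mono (le_max_left _ _)⟩
  · intro y hy
    obtain ⟨⟨i, hi⟩, j, hj⟩ := hK' y hy
    exact ⟨⟨_, ⟨_, hu i, rfl⟩, hi.mono (le_max_right _ _)⟩, _, ⟨_, hu j, rfl⟩,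
      hj.mono (le_max_right _ _)⟩

/-- If `U` is close to the image of `V` under a quasi-inverse of `f`, then the image of `U` under `f`
is close to `V`. -/
theorem IsQI.closeSets_of_inverse {f : X → Y} {γ c : ℝ} (h : IsQI f γ c) {g : Y → X}
    (hg : ∀ y, Within (f (g y)) y c ∧ Within y (f (g y)) c) {U : Set X} {V : Set Y}
    (hUV : CloseSets (g '' V) U) : CloseSets (f '' U) V := by
  rw [closeSets_iff] at hUV ⊢
  obtain ⟨K, h1, h2⟩ := hUV
  refine ⟨γ * K + c + c, ?_, ?_⟩
  · rintro _ ⟨x, hx, rfl⟩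
    obtain ⟨⟨_, ⟨y, hy, rfl⟩, hW⟩, _, ⟨y', hy', rfl⟩, hW'⟩ := h2 x hx
    refine ⟨⟨y, hy, ?_⟩, y', hy', (h.map hW').trans (hg y').1⟩
    exact ((hg y).2.trans (h.map hW)).mono (by linarith)
  · intro y hy
    obtain ⟨⟨x, hx, hW⟩, x', hx', hW'⟩ := h1 _ ⟨y, hy, rfl⟩
    refine ⟨⟨_, ⟨x, hx, rfl⟩, (h.map hW).trans (hg y).1⟩, _, ⟨x', hx', rfl⟩, ?_⟩
    exact ((hg y).2.trans (h.map hW')).mono (by linarith)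

theorem closeSets_of_bothFollows {f : X → Y} {R : QGRay X ⊕ QGAntiRay X}
    {Q : QGRay Y ⊕ QGAntiRay Y} (h : bothFollows f R Q) : CloseSets (f '' image R) (image Q) := by
  rcases h with h | h <;> exact h

theorem exists_bothFollows {δ : ℝ} {φ : ℝ → ℝ} {δ' : ℝ} {φ' : ℝ → ℝ} (H : IsHypSpace X δ φ)
    (H' : IsHypSpace Y δ' φ') {f : X → Y} {γ c : ℝ} (hf : IsQI f γ c)
    (R : QGRay X ⊕ QGAntiRay X) : ∃ Q, bothFollows f R Q := by
  obtain ⟨u, hu, hdir⟩ := H.exists_discretizes R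
  rcases R with R | R
  · obtain ⟨T, γ', c', he⟩ := hdir
    obtain ⟨Q, hQ⟩ := H'.exists_ray_of_isQGSeq (hf.isQGSeq he)
    exact ⟨Sum.inl Q, Sum.LiftRel.inl (hf.closeSets hu hQ.1)⟩
  · obtain ⟨T, γ', c', he⟩ := hdir
    obtain ⟨Q, hQ⟩ := H'.exists_antiRay_of_isQGSeq (hf.op.isQGSeq he)
    exact ⟨Sum.inr Q, Sum.LiftRel.inr (hf.closeSets hu hQ.1)⟩

theorem exists_bothFollows' {δ : ℝ} {φ : ℝ → ℝ} {δ' : ℝ} {φ' : ℝ → ℝ} (H : IsHypSpace X δ φ)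
    (H' : IsHypSpace Y δ' φ') {f : X → Y} {γ c : ℝ} (hf : IsQI f γ c)
    (Q : QGRay Y ⊕ QGAntiRay Y) : ∃ R, bothFollows f R Q := by
  obtain ⟨g, ⟨γ', c', hg⟩, hfg⟩ := hf.exists_inverse
  obtain ⟨R, hR⟩ := exists_bothFollows H' H hg Q
  refine ⟨R, ?_⟩
  rcases hR with hR | hR
  · exact Sum.LiftRel.inl (hf.closeSets_of_inverse hfg hR)
  · exact Sum.LiftRel.inr (hf.closeSets_of_inverse hfg hR)

/-- The order of (anti-)rays corresponds to the order of (anti-)rays that follow their images. -/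
theorem bothLE_iff_of_bothFollows {δ : ℝ} {φ : ℝ → ℝ} {δ' : ℝ} {φ' : ℝ → ℝ}
    (H : IsHypSpace X δ φ) (H' : IsHypSpace Y δ' φ') {f : X → Y} {γ c : ℝ} (hf : IsQI f γ c)
    {R S : QGRay X ⊕ QGAntiRay X} {Q P : QGRay Y ⊕ QGAntiRay Y} (hRQ : bothFollows f R Q)
    (hSP : bothFollows f S P) : bothLE Q P ↔ bothLE R S := by
  -- discretizations of an (anti-)ray and of one that follows its image are close
  have close : ∀ {R : QGRay X ⊕ QGAntiRay X} {Q : QGRay Y ⊕ QGAntiRay Y} {u : ℕ → X} {q : ℕ → Y},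
      bothFollows f R Q → Discretizes u R → Discretizes q Q → ∃ K,
      ((∀ i, ∃ k, Within (q k) (f (u i)) K) ∧ ∀ i, ∃ k, Within (f (u i)) (q k) K) ∧
      (∀ k, ∃ i, Within (f (u i)) (q k) K) ∧ ∀ k, ∃ i, Within (q k) (f (u i)) K := by
    intro R Q u q h hu hq
    obtain ⟨K, h1, h2⟩ := closeSets_iff.1 (closeSets_of_bothFollows h)
    obtain ⟨⟨hu0, L, hL⟩, -⟩ := hu
    obtain ⟨⟨hq0, L', hL'⟩, -⟩ := hq
    have e1 : L' + K ≤ max (L' + K) (γ * L + c + K) := le_max_left _ _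
    have e2 : γ * L + c + K ≤ max (L' + K) (γ * L + c + K) := le_max_right _ _
    refine ⟨max (L' + K) (γ * L + c + K), ⟨fun i => ?_, fun i => ?_⟩, fun k => ?_, fun k => ?_⟩
    · obtain ⟨y, hy, hW⟩ := (h1 _ ⟨_, hu0 i, rfl⟩).1
      obtain ⟨k, hk⟩ := (hL' y hy).1
      exact ⟨k, (hk.trans hW).mono e1⟩
    · obtain ⟨y, hy, hW⟩ := (h1 _ ⟨_, hu0 i, rfl⟩).2
      obtain ⟨k, hk⟩ := (hL' y hy).2
      exact ⟨k, (hW.trans hk).mono (by linarith)⟩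
    · obtain ⟨_, ⟨x, hx, rfl⟩, hW⟩ := (h2 _ (hq0 k)).1
      obtain ⟨i, hi⟩ := (hL x hx).1
      exact ⟨i, ((hf.map hi).trans hW).mono e2⟩
    · obtain ⟨_, ⟨x, hx, rfl⟩, hW⟩ := (h2 _ (hq0 k)).2
      obtain ⟨i, hi⟩ := (hL x hx).2
      exact ⟨i, (hW.trans (hf.map hi)).mono (by linarith)⟩
  obtain ⟨u, hu⟩ := H.exists_discretizes R
  obtain ⟨v, hv⟩ := H.exists_discretizes S
  obtain ⟨q, hq⟩ := H'.exists_discretizes Q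
  obtain ⟨p, hp⟩ := H'.exists_discretizes P
  obtain ⟨K, ⟨h1, -⟩, h2, -⟩ := close hRQ hu hq
  obtain ⟨K', ⟨-, h1'⟩, -, h2'⟩ := close hSP hv hp
  have pu := H'.isProperSeq (hf.isEndSeq hu.isEndSeq)
  have pv := H'.isProperSeq (hf.isEndSeq hv.isEndSeq)
  have pq := H'.isProperSeq hq.isEndSeq
  have pp := H'.isProperSeq hp.isEndSeq
  have mono : ∀ {x y : Y}, Within x y K → Within x y (max K K') := fun h => h.mono (le_max_left _ _)
  have mono' : ∀ {x y : Y}, Within x y K' → Within x y (max K K') :=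
    fun h => h.mono (le_max_right _ _)
  rw [H'.bothLE_iff hq hp, H.bothLE_iff hu hv, ← hf.seqLE_iff]
  constructor
  · exact SeqLE.of_within pq pp pu pv (fun k => (h2 k).imp fun _ => mono)
      (fun k => (h2' k).imp fun _ => mono')
  · exact SeqLE.of_within pu pv pq pp (fun i => (h1 i).imp fun _ => mono)
      (fun i => (h1' i).imp fun _ => mono')

/-! ### Maps between classes -/

theorem classOf_eq_iff {A : Type*} {le : A → A → Prop} (hrefl : ∀ R, le R R)
    (htrans : ∀ {R Q S}, le R Q → le Q S → le R S) {R Q : A} :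
    classOf le R = classOf le Q ↔ le R Q ∧ le Q R := by
  constructor
  · intro h
    have h1 : Q ∈ (classOf le R).1 := by rw [h]; exact ⟨hrefl Q, hrefl Q⟩
    exact h1
  · rintro ⟨h1, h2⟩
    refine Subtype.ext (Set.ext fun S => ?_)
    exact ⟨fun h => ⟨htrans h2 h.1, htrans h.2 h1⟩, fun h => ⟨htrans h1 h.1, htrans h.2 h2⟩⟩

theorem classOf_le_classOf_iff {A : Type*} {le : A → A → Prop} (hrefl : ∀ R, le R R)
    (htrans : ∀ {R Q S}, le R Q → le Q S → le R S) {R Q : A} :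
    classOf le R ≤ classOf le Q ↔ le R Q := by
  constructor
  · rintro ⟨R', hR', Q', hQ', h⟩
    exact htrans (htrans hR'.1 h) hQ'.2
  · exact fun h => ⟨R, ⟨hrefl R, hrefl R⟩, Q, ⟨hrefl Q, hrefl Q⟩, h⟩

/-- A correspondence between two preordered sets that relates every element of each of them to some
element of the other and is compatible with the preorders induces an order isomorphism between the
sets of classes. -/
theorem exists_isCanonicalMap {A B : Type*} {leA : A → A → Prop} {leB : B → B → Prop}
    {follows : A → B → Prop} (hreflA : ∀ R, leA R R)
    (htransA : ∀ {R Q S}, leA R Q → leA Q S → leA R S) (hreflB : ∀ R, leB R R)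
    (htransB : ∀ {R Q S}, leB R Q → leB Q S → leB R S) (hex : ∀ R, ∃ Q, follows R Q)
    (hex' : ∀ Q, ∃ R, follows R Q)
    (hle : ∀ {R S Q P}, follows R Q → follows S P → (leB Q P ↔ leA R S)) :
    ∃ F : Classes leA → Classes leB, IsCanonicalMap follows F ∧ IsOrderBijection F := by
  have hrep : ∀ η : Classes leA, ∃ R, classOf leA R = η := fun ⟨η, R, h⟩ => ⟨R, Subtype.ext h.symm⟩
  have hrepB : ∀ η : Classes leB, ∃ Q, classOf leB Q = η := fun ⟨η, R, h⟩ => ⟨R, Subtype.ext h.symm⟩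
  choose rep hrep using hrep
  choose next hnext using hex
  have hF : ∀ R Q, follows R Q → classOf leB (next (rep (classOf leA R))) = classOf leB Q := by
    intro R Q h
    have h1 := (classOf_eq_iff hreflA htransA).1 (hrep (classOf leA R))
    rw [classOf_eq_iff hreflB htransB, hle (hnext _) h, hle h (hnext _)]
    exact h1
  refine ⟨fun η => classOf leB (next (rep η)), fun R => ⟨⟨_, hnext R⟩, hF R⟩, ⟨?_, ?_⟩, ?_⟩
  · intro η μ h
    have h := (classOf_eq_iff hreflB htransB).1 h
    rw [hle (hnext _) (hnext _), hle (hnext _) (hnext _)] at h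
    rw [← hrep η, ← hrep μ]
    exact (classOf_eq_iff hreflA htransA).2 h
  · intro η
    obtain ⟨Q, rfl⟩ := hrepB η
    obtain ⟨R, hR⟩ := hex' Q
    exact ⟨classOf leA R, hF R Q hR⟩
  · intro η μ
    rw [classOf_le_classOf_iff hreflB htransB, hle (hnext _) (hnext _),
      ← classOf_le_classOf_iff hreflA htransA, hrep, hrep]

end SemimetricSpace

open SemimetricSpace in
theorem mainTheorem1 {X₁ X₂ : Type*} [SemimetricSpace X₁] [SemimetricSpace X₂]
    (hgeod₁ : IsGeodesicSpace X₁) (hgeod₂ : IsGeodesicSpace X₂)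
    (hhyp₁ : IsHyperbolic X₁) (hhyp₂ : IsHyperbolic X₂)
    (hB1₁ : PropB1 X₁) (hB2₁ : PropB2 X₁) (hB1₂ : PropB1 X₂) (hB2₂ : PropB2 X₂)
    (f : X₁ → X₂) (hf : IsQuasiIsometry f) :
    (∃ F : FBoundary X₁ → FBoundary X₂,
      IsCanonicalMap (rayFollows f) F ∧ IsOrderBijection F) ∧
    (∃ F : BBoundary X₁ → BBoundary X₂,
      IsCanonicalMap (antiRayFollows f) F ∧ IsOrderBijection F) ∧
    (∃ F : Boundary X₁ → Boundary X₂,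
      IsCanonicalMap (bothFollows f) F ∧ IsOrderBijection F) := by
  obtain ⟨δ₁, φ₁, H₁⟩ := exists_isHypSpace hgeod₁ hhyp₁ hB1₁ hB2₁
  obtain ⟨δ₂, φ₂, H₂⟩ := exists_isHypSpace hgeod₂ hhyp₂ hB1₂ hB2₂
  obtain ⟨γ, c, hf⟩ := hf.exists_isQI
  refine ⟨?_, ?_, ?_⟩
  · refine exists_isCanonicalMap (fun R => H₁.bothLE_refl (Sum.inl R))
      (fun {R Q S} => H₁.bothLE_trans (R := Sum.inl R) (Q := Sum.inl Q) (S := Sum.inl S))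
      (fun R => H₂.bothLE_refl (Sum.inl R))
      (fun {R Q S} => H₂.bothLE_trans (R := Sum.inl R) (Q := Sum.inl Q) (S := Sum.inl S))
      (fun R => ?_) (fun Q => ?_)
      (fun hRQ hSP => bothLE_iff_of_bothFollows H₁ H₂ hf (.inl hRQ) (.inl hSP))
    · obtain ⟨_, h⟩ := exists_bothFollows H₁ H₂ hf (Sum.inl R)
      cases h with
      | inl h => exact ⟨_, h⟩
    · obtain ⟨_, h⟩ := exists_bothFollows' H₁ H₂ hf (Sum.inl Q)
      cases h with
      | inl h => exact ⟨_, h⟩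
  · refine exists_isCanonicalMap (fun R => H₁.bothLE_refl (Sum.inr R))
      (fun {R Q S} => H₁.bothLE_trans (R := Sum.inr R) (Q := Sum.inr Q) (S := Sum.inr S))
      (fun R => H₂.bothLE_refl (Sum.inr R))
      (fun {R Q S} => H₂.bothLE_trans (R := Sum.inr R) (Q := Sum.inr Q) (S := Sum.inr S))
      (fun R => ?_) (fun Q => ?_)
      (fun hRQ hSP => bothLE_iff_of_bothFollows H₁ H₂ hf (.inr hRQ) (.inr hSP))
    · obtain ⟨_, h⟩ := exists_bothFollows H₁ H₂ hf (Sum.inr R)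
      cases h with
      | inr h => exact ⟨_, h⟩
    · obtain ⟨_, h⟩ := exists_bothFollows' H₁ H₂ hf (Sum.inr Q)
      cases h with
      | inr h => exact ⟨_, h⟩
  · exact exists_isCanonicalMap H₁.bothLE_refl H₁.bothLE_trans H₂.bothLE_refl H₂.bothLE_trans
      (exists_bothFollows H₁ H₂ hf) (exists_bothFollows' H₁ H₂ hf)
      (bothLE_iff_of_bothFollows H₁ H₂ hf)
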